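/- Let $n\in\{1,2,3\}$, let $p_S=\frac{n+2}{n-2}$ if $n\ge 3$ and $p_S=\infty$ if $n\in\{1,2\}$, let $\beta\in\mathbb R$, and let $p=2q+3\in(1,p_S)$. Consider the system $$-\Delta u=|u|^{2q+2}u+\beta|v|^{q+2}|u|^q u,\qquad -\Delta v=|v|^{2q+2}v+\beta|u|^{q+2}|v|^q v \qquad\text{in }\mathbb R^n, \tag{S}$$ and the half-line problem $$-u''=|u|^{2q+2}u+\beta|v|^{q+2}|u|^q u,\quad -v''=|v|^{2q+2}v+\beta|u|^{q+2}|v|^q v\quad\text{in }(0,\infty),\qquad u(0)=v(0)=0, \tag{H}$$ where $|s|^qs:=0$ for $s=0$. Classical solutions are $C^2$ (for (H): $C^2$ in $(0,\infty)$ and continuous on $[0,\infty)$), and a solution is nontrivial if $(u,v)\not\equiv(0,0)$. For an interval $J\subset\mathbb R$ and a continuous $f:J\to\mathbb R$ let the zero number $z(f)=z_J(f)\in\{0,1,\dots,\infty\}$ be the supremum of all $j$ for which there are $x_1<\dots<x_{j+1}$ in $J$ with $f(x_i)f(x_{i+1})<0$ for $i=1,\dots,j$ (with $\sup\emptyset=0$);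 if $f$ is a continuous radial function on $\mathbb R^n$, $f(x)=\tilde f(|x|)$ with $\tilde f\in C([0,\infty))$, and $(u,v)$ is considered as a radial pair, let $z(f):=z_{[0,\infty)}(\tilde f)$. Fix $C_1,C_2,C_3,C_4\ge0$ and let $\mathcal K$ be the class of pairs $(u,v)$ with $z(u)\le C_1$, $z(v)\le C_2$, $z(u-v)\le C_3$, $z(u+v)\le C_4$. Then: 1. If $\beta\ne-1$, then (S) has no nontrivial classical radial solution in $\mathcal K$, and (S) with $n=1$ has no nontrivial classical solution in $\mathcal K$, radial or not (with $J=\mathbb R$). 2. If $\beta=-1$, then every classical radial solution of (S) in $\mathcal K$ is of the form $(c,\pm c)$ with $c\in\mathbb R$. Every classical solution of (S) with $n=1$ in $\mathcal K$, radial or not, is of the form $(\ell,\pm\ell)$ with $\ell(x)=ax+b$, $a,b\in\mathbb R$; every bounded one is of the form $(c,\pm c)$ with $c\in\mathbb R$. 3. If $\beta\neq-1$, then (H) has no nontrivial classical solution in $\mathcal K$ (with $J=(0,\infty)$). For every $\beta\in\mathbb R$, (H) has no nontrivial bounded classical solution in $\mathcal K$. If $\beta=-1$, every classical solution of (H) in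 $\mathcal K$ is of the form $(ax,\pm ax)$ with $a\in\mathbb R$. -/

import Mathlib

open Set
open scoped NNReal ENNReal

noncomputable section

/-- The critical Sobolev exponent: `(n + 2) / (n - 2)` if `n ≥ 3`, and `∞` if `n ≤ 2`. -/
def sobolevCriticalExponent (n : ℕ) : EReal :=
  if 3 ≤ n then ((((n : ℝ) + 2) / ((n : ℝ) - 2) : ℝ) : EReal) else ⊤

/-- The number of sign changes of `f` on `J` (the zero number `z_J(f)`): the supremum of all `j`
such that there are `x₀ < x₁ < ⋯ < x_j` in `J` with `f (x_i) * f (x_{i+1}) < 0` for all `i < j`. -/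
def zeroNumber (J : Set ℝ) (f : ℝ → ℝ) : ℕ∞ :=
  ⨆ (j : ℕ) (_ : ∃ x : Fin (j + 1) → ℝ, StrictMono x ∧ (∀ i, x i ∈ J) ∧
    ∀ i : Fin j, f (x i.castSucc) * f (x i.succ) < 0), (j : ℕ∞)

/-- `(f, g)` belongs to the class `𝒦(C₁, C₂, C₃, C₄)` of pairs of functions on `J`. -/
def InClassK (C₁ C₂ C₃ C₄ : ℝ≥0) (J : Set ℝ) (f g : ℝ → ℝ) : Prop :=
  (zeroNumber J f : ℝ≥0∞) ≤ C₁ ∧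
  (zeroNumber J g : ℝ≥0∞) ≤ C₂ ∧
  (zeroNumber J (fun x => f x - g x) : ℝ≥0∞) ≤ C₃ ∧
  (zeroNumber J (fun x => f x + g x) : ℝ≥0∞) ≤ C₄

/-- The nonlinearity `|s|^{2q+2} s + β |t|^{q+2} |s|^q s` (for `q > -1`); its value at `s = 0`
is `0`, the continuous extension. -/
def coupledNonlinearity (q β s t : ℝ) : ℝ :=
  |s| ^ (2 * q + 2) * s + β * |t| ^ (q + 2) * |s| ^ q * s

/-- `(u, v)` is a classical (`C²`) solution on the whole space `E` of
`-Δu = |u|^{2q+2}u + β|v|^{q+2}|u|^q u`, `-Δv = |v|^{2q+2}v + β|u|^{q+2}|v|^q v`.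
It is used for `E = ℝⁿ` and for `E = ℝ`, where the Laplacian is the second derivative. -/
structure IsEntireSolution {E : Type*} [NormedAddCommGroup E] [InnerProductSpace ℝ E]
    [FiniteDimensional ℝ E] (q β : ℝ) (u v : E → ℝ) : Prop where
  contDiff_left : ContDiff ℝ 2 u
  contDiff_right : ContDiff ℝ 2 v
  eq_left : ∀ x, -((Laplacian.laplacian u : E → ℝ) x) = coupledNonlinearity q β (u x) (v x)
  eq_right : ∀ x, -((Laplacian.laplacian v : E → ℝ) x) = coupledNonlinearity q β (v x) (u x)

/-- `u` is radially symmetric with (continuous) radial profile `f` on `[0, ∞)`. -/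
def HasRadialProfile {n : ℕ} (u : EuclideanSpace ℝ (Fin n) → ℝ) (f : ℝ → ℝ) : Prop :=
  ContinuousOn f (Ici 0) ∧ ∀ x, u x = f ‖x‖

/-- `(u, v)` is a classical solution, `C²` in `(0, ∞)` and continuous on `[0, ∞)`, of the system
on the half-line `(0, ∞)` with the Dirichlet condition `u(0) = v(0) = 0`. Values at negative
arguments play no role. -/
structure IsHalfLineSolution (q β : ℝ) (u v : ℝ → ℝ) : Prop where
  continuousOn_left : ContinuousOn u (Ici 0)
  continuousOn_right : ContinuousOn v (Ici 0)
  contDiffOn_left : ContDiffOn ℝ 2 u (Ioi 0)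
  contDiffOn_right : ContDiffOn ℝ 2 v (Ioi 0)
  eq_left : ∀ x, 0 < x → -(deriv (deriv u) x) = coupledNonlinearity q β (u x) (v x)
  eq_right : ∀ x, 0 < x → -(deriv (deriv v) x) = coupledNonlinearity q β (v x) (u x)
  boundary_left : u 0 = 0
  boundary_right : v 0 = 0

end

/-! Finitely many sign changes force `u`, `v`, `u - v` and `u + v` each to keep a sign near infinity
(`exists_constSign`). The system is invariant under exchanging the components and under changing the
sign of either one, so one may assume `0 ≤ v ≤ u` on some `(R, ∞)`. What remains outside a ball is a
Liouville argument for a scalar differential inequality.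

If `β > -1`, the larger component satisfies `-Δu ≥ c u^p` with `c = min 1 (1 + β)`
(`RadialSol.eq_zero_exterior`). If `β ≤ -1`, the difference satisfies `-Δ(u - v) ≥ u^(p-1) (u - v)`,
while `v` is subharmonic (`RadialSol.eq_exterior`). In dimensions one and two such inequalities
leave only zero in an exterior domain (`eq_zero_of_exterior_lowDim`). In dimension three they no
longer suffice for `p > 3`; there they only give the decay rate `r^(-2/(p-1))`. With this decay the
Pohozaev function, which vanishes at the origin and is nondecreasing for `p < 5`, has a limit at
infinity that is at most zero, so it is identically zero and the solution is constant
(`RadialSol.deriv_eq_zero_of_decay`).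

A backward Gronwall estimate carries `u = v` from the exterior to all `r > 0`
(`RadialSol.eq_of_eq_exterior`). So the solution vanishes if `β > -1`, and `u = ±v` if `β ≤ -1`
(`RadialSol.dichotomy`). In the second case `u` solves `Δw = -(1 + β)|w|^(p-1) w`: for `β < -1`
every nonzero global solution would blow up, and for `β = -1` the equation is linear and is
integrated explicitly. Solutions on the line are restricted to half-lines, where they solve the
radial system with `k = 0`. -/

/-! ### Algebra and bounds for the nonlinearity -/

theorem coupledNonlinearity_neg_left (q β s t : ℝ) :
    coupledNonlinearity q β (-s) t = -coupledNonlinearity q β s t := by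
  simp only [coupledNonlinearity, abs_neg]; ring

theorem coupledNonlinearity_neg_right (q β s t : ℝ) :
    coupledNonlinearity q β s (-t) = coupledNonlinearity q β s t := by
  simp only [coupledNonlinearity, abs_neg]

theorem coupledNonlinearity_zero_left (q β t : ℝ) : coupledNonlinearity q β 0 t = 0 := by
  simp [coupledNonlinearity]

theorem abs_rpow_add_two (q : ℝ) {s : ℝ} (hs : s ≠ 0) : |s| ^ (q + 2) = |s| ^ q * s ^ 2 := by
  rw [Real.rpow_add (abs_pos.2 hs), ← sq_abs s]
  norm_cast

theorem abs_rpow_two_mul_add_two (q : ℝ) {s : ℝ} (hs : s ≠ 0) :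
    |s| ^ (2 * q + 2) = (|s| ^ q * |s|) ^ 2 := by
  rw [Real.rpow_add (abs_pos.2 hs), two_mul, Real.rpow_add (abs_pos.2 hs), mul_pow]
  norm_cast; ring

theorem coupledNonlinearity_self (q β s : ℝ) :
    coupledNonlinearity q β s s = (1 + β) * (|s| ^ (2 * q + 2) * s) := by
  rcases eq_or_ne s 0 with rfl | hs
  · simp [coupledNonlinearity]
  · rw [coupledNonlinearity, abs_rpow_two_mul_add_two q hs, abs_rpow_add_two q hs, mul_pow, sq_abs]
    ring

theorem coupledNonlinearity_of_eq_or_neg (q β : ℝ) {s t : ℝ} (h : s = t ∨ s = -t) :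
    coupledNonlinearity q β s t = (1 + β) * (|s| ^ (2 * q + 2) * s) := by
  rcases h with rfl | h
  · exact coupledNonlinearity_self q β s
  · rw [← coupledNonlinearity_neg_right, ← h, coupledNonlinearity_self]

theorem rpow_mul_rpow_le {q s t : ℝ} (hq : -1 < q) (ht : 0 ≤ t) (hts : t ≤ s) :
    t ^ (q + 2) * s ^ q * s ≤ s ^ (2 * q + 2) * s := by
  rcases (ht.trans hts).eq_or_lt with rfl | hs
  · simp
  · have h1 : t ^ (q + 2) ≤ s ^ (q + 2) := Real.rpow_le_rpow ht hts (by linarith)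
    have h2 : s ^ (2 * q + 2) = s ^ (q + 2) * s ^ q := by
      rw [← Real.rpow_add hs]; ring_nf
    rw [h2]
    gcongr

/-- For `β ≥ 0` the coupling term is dropped; for `β ≤ 0` it is at worst `β` times the pure power,
because `t ≤ s`. The constant is positive exactly when `β > -1`. -/
theorem le_coupledNonlinearity {q β s t : ℝ} (hq : -1 < q) (ht : 0 ≤ t) (hts : t ≤ s) :
    min 1 (1 + β) * s ^ (2 * q + 2) * s ≤ coupledNonlinearity q β s t := by
  have hs := ht.trans hts
  have h1 := rpow_mul_rpow_le hq ht hts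
  have h0 : 0 ≤ t ^ (q + 2) * s ^ q * s := by positivity
  have h2 : 0 ≤ s ^ (2 * q + 2) * s := by positivity
  rw [coupledNonlinearity, abs_of_nonneg ht, abs_of_nonneg hs]
  rcases le_total 0 β with hβ | hβ
  · rw [min_eq_left (by linarith)]
    nlinarith [mul_nonneg hβ h0]
  · rw [min_eq_right (by linarith)]
    nlinarith [mul_le_mul_of_nonpos_left h1 hβ]

/-- For `β ≤ -1` the coupling dominates the self-interaction of the smaller component, which is
therefore subharmonic. -/
theorem coupledNonlinearity_nonpos {q β s t : ℝ} (hq : -1 < q) (hβ : β ≤ -1) (ht : 0 ≤ t)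
    (hts : t ≤ s) : coupledNonlinearity q β t s ≤ 0 := by
  rcases ht.eq_or_lt with rfl | ht'
  · rw [coupledNonlinearity_zero_left]
  have hs := ht.trans hts
  have h2 : t ^ (2 * q + 2) = t ^ (q + 2) * t ^ q := by
    rw [← Real.rpow_add ht']; ring_nf
  have h1 : t ^ (q + 2) ≤ s ^ (q + 2) := Real.rpow_le_rpow ht hts (by linarith)
  have h3 : t ^ (q + 2) * t ^ q * t ≤ s ^ (q + 2) * t ^ q * t := by gcongr
  have h4 : 0 ≤ s ^ (q + 2) * t ^ q * t := by positivity
  rw [coupledNonlinearity, abs_of_nonneg ht, abs_of_nonneg hs, h2]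
  nlinarith [mul_le_mul_of_nonneg_right hβ h4]

/-- The two coupling terms share the factor `|s|^q s |t|^q t`, and what is left of them is `t - s`.
-/
theorem coupledNonlinearity_sub_swap {q β s t : ℝ} (hq : -1 < q) :
    coupledNonlinearity q β s t - coupledNonlinearity q β t s =
      |s| ^ (2 * q + 2) * s - |t| ^ (2 * q + 2) * t -
        β * (|s| ^ q * s * (|t| ^ q * t) * (s - t)) := by
  have h2 : q + 2 ≠ 0 := by linarith
  rcases eq_or_ne s 0 with rfl | hs
  · simp [coupledNonlinearity, Real.zero_rpow h2]
  rcases eq_or_ne t 0 with rfl | ht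
  · simp [coupledNonlinearity, Real.zero_rpow h2]
  rw [coupledNonlinearity, coupledNonlinearity, abs_rpow_add_two q hs, abs_rpow_add_two q ht]
  ring

/-- In the factored difference, `β ≤ -1` makes the coupling contribute at least `s^(q+1) t^(q+1) (s
- t) ≥ 0`; the pure powers alone give the bound. -/
theorem le_coupledNonlinearity_sub_swap {q β s t : ℝ} (hq : -1 < q) (hβ : β ≤ -1) (ht : 0 ≤ t)
    (hts : t ≤ s) :
    s ^ (2 * q + 2) * (s - t) ≤ coupledNonlinearity q β s t - coupledNonlinearity q β t s := by
  have hs := ht.trans hts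
  rw [coupledNonlinearity_sub_swap hq, abs_of_nonneg ht, abs_of_nonneg hs]
  have h1 : t ^ (2 * q + 2) * t ≤ s ^ (2 * q + 2) * t := by gcongr; linarith
  have h2 : 0 ≤ s ^ q * s * (t ^ q * t) * (s - t) := by
    have := sub_nonneg.2 hts
    positivity
  nlinarith [mul_le_mul_of_nonneg_right hβ h2]

theorem abs_rpow_mul_self (q : ℝ) (hq : -1 < q) (s : ℝ) : |s| ^ q * |s| = |s| ^ (q + 1) := by
  rcases eq_or_ne s 0 with rfl | hs
  · simp [Real.zero_rpow (show q + 1 ≠ 0 by linarith)]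
  · rw [Real.rpow_add (abs_pos.2 hs), Real.rpow_one]

theorem rpow_mul_self_of_nonneg {a M : ℝ} (ha : a + 1 ≠ 0) (hM : 0 ≤ M) :
    M ^ a * M = M ^ (a + 1) := by
  rw [Real.rpow_add_one' hM ha]

theorem abs_coupledNonlinearity_le {q β s t M : ℝ} (hq : -1 < q) (hs : |s| ≤ M) (ht : |t| ≤ M) :
    |coupledNonlinearity q β s t| ≤ (1 + |β|) * M ^ (2 * q + 3) := by
  have hM : 0 ≤ M := (abs_nonneg s).trans hs
  have h1 : |(|s| ^ (2 * q + 2) * s)| ≤ M ^ (2 * q + 3) := by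
    rw [abs_mul, abs_of_nonneg (by positivity : 0 ≤ |s| ^ (2 * q + 2)),
      abs_rpow_mul_self _ (by linarith)]
    calc _ ≤ M ^ (2 * q + 2 + 1) := Real.rpow_le_rpow (abs_nonneg _) hs (by linarith)
      _ = _ := by ring_nf
  have h2 : |(|t| ^ (q + 2) * |s| ^ q * s)| ≤ M ^ (2 * q + 3) := by
    rw [abs_mul, abs_of_nonneg (by positivity : 0 ≤ |t| ^ (q + 2) * |s| ^ q), mul_assoc,
      abs_rpow_mul_self _ hq]
    calc _ ≤ M ^ (q + 2) * M ^ (q + 1) :=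
          mul_le_mul (Real.rpow_le_rpow (abs_nonneg _) ht (by linarith))
            (Real.rpow_le_rpow (abs_nonneg _) hs (by linarith)) (by positivity) (by positivity)
      _ = M ^ (2 * q + 3) := by
        rw [← Real.rpow_add' hM (by linarith)]; ring_nf
  calc |coupledNonlinearity q β s t|
      = |(|s| ^ (2 * q + 2) * s) + β * (|t| ^ (q + 2) * |s| ^ q * s)| := by
        rw [coupledNonlinearity]; ring_nf
    _ ≤ M ^ (2 * q + 3) + |β| * M ^ (2 * q + 3) := by
        refine (abs_add_le _ _).trans (add_le_add h1 ?_)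
        rw [abs_mul]
        gcongr
    _ = _ := by ring

theorem abs_rpow_mul_sub_le {a s t M : ℝ} (ha : 0 < a) (hs : |s| ≤ M) (ht : |t| ≤ M) :
    |(|s| ^ a * s - |t| ^ a * t)| ≤ (a + 1) * M ^ a * |s - t| := by
  have hM : 0 ≤ M := (abs_nonneg s).trans hs
  have hd : ∀ x : ℝ, HasDerivAt (fun x : ℝ => |x| ^ a * x) ((a + 1) * |x| ^ a) x := by
    intro x
    rcases eq_or_ne x 0 with rfl | hx
    -- At the origin the difference quotient is `|y|^a`, which tends to `0` because `a > 0`.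
    · rw [hasDerivAt_iff_tendsto_slope]
      simp only [abs_zero, Real.zero_rpow ha.ne', mul_zero]
      have hc : Filter.Tendsto (fun y : ℝ => |y| ^ a) (nhdsWithin 0 {0}ᶜ) (nhds 0) := by
        have : ContinuousAt (fun y : ℝ => |y| ^ a) 0 :=
          (continuous_abs.continuousAt).rpow_const (Or.inr ha.le)
        have h0 := this.tendsto
        simp only [abs_zero, Real.zero_rpow ha.ne'] at h0
        exact h0.mono_left nhdsWithin_le_nhds
      refine hc.congr' ?_
      filter_upwards [self_mem_nhdsWithin] with y hy
      have hy : y ≠ 0 := hy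
      simp [slope_def_field, hy]
    · have h1 := ((hasDerivAt_abs hx).rpow_const (p := a) (Or.inl (abs_ne_zero.2 hx))).mul
        (hasDerivAt_id x)
      refine h1.congr_deriv ?_
      have : |x| ^ a = |x| ^ (a - 1) * |x| := by
        rw [rpow_mul_self_of_nonneg (by simpa using ha.ne') (abs_nonneg x)]; ring_nf
      have h3 : (SignType.sign x : ℝ) * x = |x| := by
        rw [sign_mul_self]
      simp only [id]
      rw [this, ← h3]; ring
  have hconv : Convex ℝ (Icc (-M) M) := convex_Icc _ _
  have := hconv.norm_image_sub_le_of_norm_hasDerivWithin_le (C := (a + 1) * M ^ a)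
    (fun x _ => (hd x).hasDerivWithinAt) (fun x hx => by
      rw [Real.norm_eq_abs, abs_of_nonneg (by positivity)]
      have : |x| ≤ M := abs_le.2 hx
      gcongr) (abs_le.1 ht) (abs_le.1 hs)
  simpa [Real.norm_eq_abs] using this

/-- For `q < 0` the coupling `|s|^q s` is not Lipschitz at `0`, so uniqueness for the full system is
not available. The factor `s - t` in `coupledNonlinearity_sub_swap` still makes the difference of
the two equations linear in `u - v`, which is all that unique continuation of `u = v` needs. -/
theorem abs_coupledNonlinearity_sub_swap_le {q β s t M : ℝ} (hq : -1 < q) (hs : |s| ≤ M)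
    (ht : |t| ≤ M) :
    |coupledNonlinearity q β s t - coupledNonlinearity q β t s| ≤
      ((2 * q + 3) + |β|) * M ^ (2 * q + 2) * |s - t| := by
  have hM : 0 ≤ M := (abs_nonneg s).trans hs
  rw [coupledNonlinearity_sub_swap hq]
  have h1 := abs_rpow_mul_sub_le (a := 2 * q + 2) (by linarith) hs ht
  have h2 : |β * (|s| ^ q * s * (|t| ^ q * t) * (s - t))| ≤
      |β| * (M ^ (2 * q + 2) * |s - t|) := by
    rw [abs_mul, abs_mul, abs_mul, abs_mul, abs_mul, abs_of_nonneg (by positivity : 0 ≤ |s| ^ q),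
      abs_of_nonneg (by positivity : 0 ≤ |t| ^ q), abs_rpow_mul_self _ hq, abs_rpow_mul_self _ hq]
    gcongr
    calc _ ≤ M ^ (q + 1) * M ^ (q + 1) :=
          mul_le_mul (Real.rpow_le_rpow (abs_nonneg _) hs (by linarith))
            (Real.rpow_le_rpow (abs_nonneg _) ht (by linarith)) (by positivity) (by positivity)
      _ = M ^ (2 * q + 2) := by
        rw [← Real.rpow_add' hM (by linarith)]; ring_nf
  calc _ ≤ _ := abs_sub _ _
    _ ≤ _ := add_le_add h1 h2
    _ = _ := by ring

/-! ### The potential -/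

/-- The potential whose gradient is the nonlinearity of the system. -/
noncomputable def couplingPotential (q β s t : ℝ) : ℝ :=
  (|s| ^ (2 * q + 4) + |t| ^ (2 * q + 4)) / (2 * q + 4) +
    β * (|s| ^ (q + 2) * |t| ^ (q + 2)) / (q + 2)

theorem hasDerivAt_couplingPotential {q β : ℝ} (hq : -1 < q) {u v : ℝ → ℝ} {u' v' x : ℝ}
    (hu : HasDerivAt u u' x) (hv : HasDerivAt v v' x) :
    HasDerivAt (fun r => couplingPotential q β (u r) (v r))
      (coupledNonlinearity q β (u x) (v x) * u' + coupledNonlinearity q β (v x) (u x) * v') x := by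
  have h4 : (2 * q + 4) ≠ 0 := by linarith
  have h2 : (q + 2) ≠ 0 := by linarith
  have d4 : ∀ {w : ℝ → ℝ} {w' : ℝ}, HasDerivAt w w' x → HasDerivAt (fun r => |w r| ^ (2 * q + 4))
      ((2 * q + 4) * |w x| ^ (2 * q + 4 - 2) * w x * w') x := fun hw =>
    (hasDerivAt_abs_rpow _ (by linarith)).comp x hw
  have d2 : ∀ {w : ℝ → ℝ} {w' : ℝ}, HasDerivAt w w' x → HasDerivAt (fun r => |w r| ^ (q + 2))
      ((q + 2) * |w x| ^ (q + 2 - 2) * w x * w') x := fun hw =>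
    (hasDerivAt_abs_rpow _ (by linarith)).comp x hw
  have := (((d4 hu).add (d4 hv)).div_const (2 * q + 4)).add
    ((((d2 hu).mul (d2 hv)).const_mul β).div_const (q + 2))
  refine this.congr_deriv ?_
  have e1 : 2 * q + 4 - 2 = 2 * q + 2 := by ring
  have e2 : q + 2 - 2 = q := by ring
  rw [e1, e2, coupledNonlinearity, coupledNonlinearity]
  field_simp
  ring

/-- Euler's identity: the potential is homogeneous of degree `2q + 4 = p + 1`. -/
theorem coupledNonlinearity_mul_add {q β s t : ℝ} (hq : -1 < q) :
    s * coupledNonlinearity q β s t + t * coupledNonlinearity q β t s =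
      (2 * q + 4) * couplingPotential q β s t := by
  have h4 : (2 * q + 4) ≠ 0 := by linarith
  have h2 : (q + 2) ≠ 0 := by linarith
  have e : ∀ {a : ℝ} (x : ℝ), a + 2 ≠ 0 → |x| ^ (a + 2) = |x| ^ a * x ^ 2 := by
    intro a x ha
    rcases eq_or_ne x 0 with rfl | hx
    · simp [Real.zero_rpow ha]
    · exact abs_rpow_add_two a hx
  have e1 : 2 * q + 4 = (2 * q + 2) + 2 := by ring
  rw [couplingPotential, mul_add, mul_div_cancel₀ _ h4, e1, e s (by linarith), e t (by linarith),
    coupledNonlinearity, coupledNonlinearity, e s h2, e t h2]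
  field_simp
  ring

/-- Follows from Euler's identity and the bound on the nonlinearity; the factor `2q + 4 ≥ 2` absorbs
the sum of the two terms. -/
theorem abs_couplingPotential_le {q β s t M : ℝ} (hq : -1 < q) (hs : |s| ≤ M) (ht : |t| ≤ M) :
    |couplingPotential q β s t| ≤ (1 + |β|) * (M ^ (2 * q + 2) * M ^ 2) := by
  have hM : 0 ≤ M := (abs_nonneg s).trans hs
  have h1 := abs_coupledNonlinearity_le (β := β) hq hs ht
  have h2 := abs_coupledNonlinearity_le (β := β) hq ht hs
  have h3 := coupledNonlinearity_mul_add (β := β) (s := s) (t := t) hq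
  have h4 : M ^ (2 * q + 3) * M = M ^ (2 * q + 2) * M ^ 2 := by
    have : M ^ (2 * q + 3) = M ^ (2 * q + 2) * M := by
      rw [rpow_mul_self_of_nonneg (by linarith) hM]; ring_nf
    rw [this]; ring
  have h5 : |(2 * q + 4) * couplingPotential q β s t| ≤
      2 * ((1 + |β|) * (M ^ (2 * q + 2) * M ^ 2)) := by
    rw [← h3, ← h4]
    calc _ ≤ |s * coupledNonlinearity q β s t| + |t * coupledNonlinearity q β t s| :=
          abs_add_le _ _
      _ ≤ M * ((1 + |β|) * M ^ (2 * q + 3)) + M * ((1 + |β|) * M ^ (2 * q + 3)) := by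
          rw [abs_mul, abs_mul]; gcongr
      _ = _ := by ring
  rw [abs_mul, abs_of_pos (by linarith)] at h5
  nlinarith [abs_nonneg (couplingPotential q β s t)]

/-! ### Differential inequalities on `(R, ∞)`: low dimensions and blow-up -/

theorem monotoneOn_Ioi_of_hasDerivAt {R : ℝ} {f f' : ℝ → ℝ}
    (h : ∀ x, R < x → HasDerivAt f (f' x) x) (h0 : ∀ x, R < x → 0 ≤ f' x) :
    MonotoneOn f (Ioi R) := by
  refine monotoneOn_of_deriv_nonneg (convex_Ioi R)
    (fun x hx => (h x hx).continuousAt.continuousWithinAt) ?_ ?_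
  · rw [interior_Ioi]
    exact fun x hx => (h x hx).differentiableAt.differentiableWithinAt
  · rw [interior_Ioi]
    intro x hx
    rw [(h x hx).deriv]
    exact h0 x hx

theorem antitoneOn_Ioi_of_hasDerivAt {R : ℝ} {f f' : ℝ → ℝ}
    (h : ∀ x, R < x → HasDerivAt f (f' x) x) (h0 : ∀ x, R < x → f' x ≤ 0) :
    AntitoneOn f (Ioi R) := by
  have := monotoneOn_Ioi_of_hasDerivAt (f := fun x => -f x) (f' := fun x => -f' x)
    (fun x hx => (h x hx).neg) (fun x hx => by have := h0 x hx; linarith)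
  intro a ha b hb hab
  have := this ha hb hab
  simp only at this
  linarith

/-- A function whose derivative is at most `-κ < 0` takes negative values. -/
theorem exists_neg_of_deriv_le {R κ : ℝ} (hκ : 0 < κ) {f f' : ℝ → ℝ}
    (h : ∀ x, R < x → HasDerivAt f (f' x) x) (h0 : ∀ x, R < x → f' x ≤ -κ) :
    ∃ x, R < x ∧ f x < 0 := by
  have hanti := antitoneOn_Ioi_of_hasDerivAt (f := fun x => f x + κ * x)
    (f' := fun x => f' x + κ * 1)
    (fun x hx => (h x hx).add ((hasDerivAt_id x).const_mul κ))
    (fun x hx => by have := h0 x hx; linarith)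
  set b := R + 1 + (|f (R + 1)| + 1) / κ with hb
  have hpos : 0 < (|f (R + 1)| + 1) / κ := by positivity
  have h1 := hanti (a := R + 1) (by simp) (b := b) (by simp only [mem_Ioi]; linarith) (by linarith)
  refine ⟨b, by linarith, ?_⟩
  have h2 : κ * b = κ * (R + 1) + (|f (R + 1)| + 1) := by
    rw [hb]; field_simp
  simp only at h1
  have := le_abs_self (f (R + 1))
  linarith

/-- `z'' + (k / r) z' = -g` in divergence form. -/
theorem hasDerivAt_pow_mul_radial {k : ℕ} {r : ℝ} (hr : r ≠ 0) {z1 : ℝ → ℝ} {g : ℝ}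
    (hz1 : HasDerivAt z1 (-(k / r) * z1 r - g) r) :
    HasDerivAt (fun r => r ^ k * z1 r) (-(r ^ k * g)) r := by
  refine ((hasDerivAt_pow k r).mul hz1).congr_deriv ?_
  rcases k with _ | k
  · simp
  · rw [Nat.add_sub_cancel, pow_succ]
    field_simp
    ring

/-- A nonnegative function with `(r^k z')' ≤ 0`, `k ≤ 1`, is nondecreasing. -/
theorem deriv_nonneg_of_superharmonic {k : ℕ} (hk : k ≤ 1) {R : ℝ} (hR : 0 ≤ R)
    {z z1 g : ℝ → ℝ} (hz : ∀ r, R < r → HasDerivAt z (z1 r) r)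
    (hz1 : ∀ r, R < r → HasDerivAt z1 (-(k / r) * z1 r - g r) r)
    (hnn : ∀ r, R < r → 0 ≤ z r) (hg : ∀ r, R < r → 0 ≤ g r) :
    ∀ r, R < r → 0 ≤ z1 r := by
  have hθ : ∀ r, R < r → HasDerivAt (fun r => r ^ k * z1 r) (-(r ^ k * g r)) r := fun r hr =>
    hasDerivAt_pow_mul_radial (by linarith) (hz1 r hr)
  have hanti := antitoneOn_Ioi_of_hasDerivAt hθ (fun r hr => by
    have := hg r hr
    have hr0 : 0 ≤ r := by linarith
    have : 0 ≤ r ^ k * g r := by positivity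
    linarith)
  intro r1 hr1
  by_contra hneg
  push Not at hneg
  have hr10 : 0 < r1 := by linarith
  set d := -(r1 ^ k * z1 r1) with hd
  have hdpos : 0 < d := by
    have : 0 < r1 ^ k := by positivity
    rw [hd]; nlinarith
  -- The flux `r^k z'` stays below `-d`. Beyond `1` one has `r^k ≤ r`, since `k ≤ 1`, so `z' ≤ -d /
  -- r`; the divergence of the logarithm then makes `z` negative.
  set r2 := max r1 1
  have hb : ∀ r, r2 < r → z1 r ≤ -(d / r) := by
    intro r hr
    have h1r : 1 < r := lt_of_le_of_lt (le_max_right _ _) hr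
    have hr1r : r1 < r := lt_of_le_of_lt (le_max_left _ _) hr
    have := hanti (a := r1) hr1 (b := r) (lt_trans hr1 hr1r) hr1r.le
    simp only at this
    have h2 : r ^ k * z1 r ≤ -d := by rw [hd]; linarith
    have hkr : r ^ k ≤ r := by
      calc r ^ k ≤ r ^ 1 := pow_le_pow_right₀ h1r.le hk
        _ = r := pow_one r
    have hkp : 0 < r ^ k := by positivity
    have hz1neg : z1 r ≤ 0 := by
      by_contra hc
      push Not at hc
      have : 0 < r ^ k * z1 r := by positivity
      linarith
    have h3 : r * z1 r ≤ r ^ k * z1 r := mul_le_mul_of_nonpos_right hkr hz1neg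
    rw [← neg_div, le_div_iff₀ (by linarith)]
    linarith
  have hr21 : 1 ≤ r2 := le_max_right _ _
  have hlog := antitoneOn_Ioi_of_hasDerivAt (R := r2) (f := fun r => z r + d * Real.log r)
    (f' := fun r => z1 r + d * r⁻¹)
    (fun r hr => (hz r (lt_trans hr1 (lt_of_le_of_lt (le_max_left _ _) hr))).add
      ((Real.hasDerivAt_log (by linarith)).const_mul d))
    (fun r hr => by have := hb r hr; rw [div_eq_mul_inv] at this; linarith)
  set A := z (r2 + 1) + d * Real.log (r2 + 1) with hA
  obtain ⟨r, hr⟩ := ((Real.tendsto_log_atTop.eventually_gt_atTop (A / d)).and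
    (Filter.eventually_gt_atTop (r2 + 1))).exists
  have h1 := hlog (a := r2 + 1) (by simp) (b := r) (by simp only [mem_Ioi]; linarith) hr.2.le
  have h2 := hr.1
  rw [div_lt_iff₀ hdpos] at h2
  have h3 := hnn r (lt_trans hr1 (lt_of_le_of_lt (le_max_left _ _) (by linarith : r2 < r)))
  simp only at h1
  linarith

/-- In dimension at most two, `-Δz ≥ c z^{s+1}` has no positive radial solution in an exterior
domain. -/
theorem eq_zero_of_exterior_lowDim {k : ℕ} (hk : k ≤ 1) {R : ℝ} (hR : 0 ≤ R) {c s : ℝ}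
    (hc : 0 < c) (hs : 0 < s)
    {z z1 g : ℝ → ℝ} (hz : ∀ r, R < r → HasDerivAt z (z1 r) r)
    (hz1 : ∀ r, R < r → HasDerivAt z1 (-(k / r) * z1 r - g r) r)
    (hnn : ∀ r, R < r → 0 ≤ z r) (hg : ∀ r, R < r → c * z r ^ s * z r ≤ g r) :
    ∀ r, R < r → z r = 0 := by
  have hg0 : ∀ r, R < r → 0 ≤ g r := fun r hr => le_trans (by
    have := hnn r hr; positivity) (hg r hr)
  have h1 := deriv_nonneg_of_superharmonic hk hR hz hz1 hnn hg0
  have hmono := monotoneOn_Ioi_of_hasDerivAt hz h1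
  intro r0 hr0
  by_contra hne
  have hδ : 0 < z r0 := lt_of_le_of_ne (hnn r0 hr0) (Ne.symm hne)
  -- As `z` is nondecreasing, it stays above `z r0 > 0`, so the flux `r^k z'` falls at a fixed rate
  -- and turns negative, against `z' ≥ 0`.
  obtain ⟨x, hx, hxneg⟩ := exists_neg_of_deriv_le (R := max r0 1) (κ := c * z r0 ^ s * z r0)
    (f := fun r => r ^ k * z1 r) (f' := fun r => -(r ^ k * g r)) (by positivity)
    (fun r hr => by
      have hr1 : 1 < r := lt_of_le_of_lt (le_max_right _ _) hr
      have hr0' : r0 < r := lt_of_le_of_lt (le_max_left _ _) hr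
      exact hasDerivAt_pow_mul_radial (by linarith) (hz1 r (hr0.trans hr0')))
    (fun r hr => by
      have hr1 : 1 < r := lt_of_le_of_lt (le_max_right _ _) hr
      have hr0' : r0 < r := lt_of_le_of_lt (le_max_left _ _) hr
      have hm := hmono (a := r0) hr0 (b := r) (hr0.trans hr0') hr0'.le
      have hz0 := hδ.le.trans hm
      have h2 : c * z r0 ^ s * z r0 ≤ c * z r ^ s * z r := by
        have : 0 ≤ c * z r ^ s := by positivity
        gcongr
      have h3 := hg r (hr0.trans hr0')
      have h4 : 1 ≤ r ^ k := one_le_pow₀ hr1.le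
      have h5 := hg0 r (hr0.trans hr0')
      nlinarith)
  have hr1 : 1 < x := lt_of_le_of_lt (le_max_right _ _) hx
  have hr0' : r0 < x := lt_of_le_of_lt (le_max_left _ _) hx
  have := h1 x (hr0.trans hr0')
  have : 0 ≤ x ^ k * z1 x := by positivity
  linarith

/-- Solutions of `h'' ≥ κ h^s`, `s > 1`, that are increasing somewhere blow up. -/
theorem false_of_superlinear_growth {x0 κ s : ℝ} (hκ : 0 < κ) (hs : 1 < s) {h h1 h2 : ℝ → ℝ}
    (hh : ∀ x, x0 < x → HasDerivAt h (h1 x) x) (hh1 : ∀ x, x0 < x → HasDerivAt h1 (h2 x) x)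
    (hnn : ∀ x, x0 < x → 0 ≤ h x) (hle : ∀ x, x0 < x → κ * h x ^ s ≤ h2 x)
    {y : ℝ} (hy : x0 < y) (hpos : 0 < h1 y) : False := by
  have hmono1 := monotoneOn_Ioi_of_hasDerivAt hh1 (fun x hx =>
    le_trans (by have := hnn x hx; positivity) (hle x hx))
  have hd : ∀ x, y < x → h1 y ≤ h1 x := fun x hx => hmono1 hy (hy.trans hx) hx.le
  have hlin := monotoneOn_Ioi_of_hasDerivAt (R := y) (f := fun x => h x - h1 y * x)
    (f' := fun x => h1 x - h1 y * 1)
    (fun x hx => (hh x (hy.trans hx)).sub ((hasDerivAt_id x).const_mul _))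
    (fun x hx => by have := hd x hx; linarith)
  have hs1 : (0 : ℝ) < s + 1 := by linarith
  -- Multiplying `h'' ≥ κ h^s` by `2 h' > 0` shows that this energy is nondecreasing.
  have henergy := monotoneOn_Ioi_of_hasDerivAt (R := y)
    (f := fun x => h1 x ^ 2 - 2 * κ / (s + 1) * h x ^ (s + 1))
    (f' := fun x => (2 : ℕ) * h1 x ^ (2 - 1) * h2 x -
      2 * κ / (s + 1) * (h1 x * (s + 1) * h x ^ (s + 1 - 1)))
    (fun x hx => ((hh1 x (hy.trans hx)).pow 2).sub
      (((hh x (hy.trans hx)).rpow_const (Or.inr (by linarith))).const_mul _))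
    (fun x hx => by
      have e1 := hd x hx
      have e2 := hle x (hy.trans hx)
      have e3 : s + 1 - 1 = s := by ring
      rw [e3]
      have e4 : 2 * κ / (s + 1) * (h1 x * (s + 1) * h x ^ s) = 2 * h1 x * (κ * h x ^ s) := by
        field_simp
      rw [e4]
      push_cast
      simp only [pow_one]
      nlinarith)
  set A := h1 (y + 1) ^ 2 - 2 * κ / (s + 1) * h (y + 1) ^ (s + 1) with hA
  have htend : Filter.Tendsto h Filter.atTop Filter.atTop := by
    refine Filter.tendsto_atTop_mono' _ (f₁ := fun x => (h (y + 1) - h1 y * (y + 1)) + h1 y * x)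
      ?_ ?_
    · filter_upwards [Filter.eventually_gt_atTop (y + 1)] with x hx
      have := hlin (a := y + 1) (by simp) (b := x) (by simp only [mem_Ioi]; linarith) hx.le
      simp only at this
      linarith
    · exact Filter.tendsto_atTop_add_const_left _ _ (Filter.tendsto_id.const_mul_atTop hpos)
  have htend2 := (tendsto_rpow_atTop hs1).comp htend
  -- Past `x1` half of the potential term outweighs the constant `A`; the other half bounds `h'²`
  -- from below.
  obtain ⟨x1, hx1⟩ := Filter.eventually_atTop.1
    ((htend2.eventually_ge_atTop (-A / (κ / (s + 1)))).and (htend.eventually_ge_atTop 1))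
  set κ' := Real.sqrt (κ / (s + 1)) with hκ'
  have hκ'pos : 0 < κ' := Real.sqrt_pos.2 (by positivity)
  have hgrow : ∀ x, max x1 (y + 1) < x → κ' * h x ^ ((s + 1) / 2) ≤ h1 x := by
    intro x hx
    have hxx1 : x1 < x := lt_of_le_of_lt (le_max_left _ _) hx
    have hxy : y + 1 < x := lt_of_le_of_lt (le_max_right _ _) hx
    obtain ⟨e1, e2⟩ := hx1 x hxx1.le
    have e3 := henergy (a := y + 1) (by simp) (b := x) (by simp only [mem_Ioi]; linarith) hxy.le
    simp only [Function.comp] at e1 e3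
    rw [div_le_iff₀ (by positivity)] at e1
    have e4 : κ / (s + 1) * h x ^ (s + 1) ≤ h1 x ^ 2 := by
      have : 2 * κ / (s + 1) * h x ^ (s + 1) = 2 * (h x ^ (s + 1) * (κ / (s + 1))) := by ring
      rw [this] at e3
      linarith
    have e5 : (κ' * h x ^ ((s + 1) / 2)) ^ 2 = κ / (s + 1) * h x ^ (s + 1) := by
      rw [mul_pow, hκ', Real.sq_sqrt (by positivity), ← Real.rpow_natCast (h x ^ ((s + 1) / 2)),
        ← Real.rpow_mul (by linarith)]
      congr 2
      push_cast; ring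
    rw [← e5] at e4
    exact le_of_sq_le_sq e4 (hpos.le.trans (hd x (by linarith)))
  -- By `h' ≥ κ' h^((s+1)/2)` the positive function `h^(-(s-1)/2)` decreases at a fixed positive
  -- rate, which is impossible for all time.
  obtain ⟨x, hx, hxneg⟩ := exists_neg_of_deriv_le (R := max x1 (y + 1))
    (κ := (s - 1) / 2 * κ') (f := fun x => h x ^ (-((s - 1) / 2)))
    (f' := fun x => h1 x * (-((s - 1) / 2)) * h x ^ (-((s - 1) / 2) - 1))
    (mul_pos (by linarith) hκ'pos)
    (fun x hx => by
      have hxx1 : x1 < x := lt_of_le_of_lt (le_max_left _ _) hx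
      have hxy : y + 1 < x := lt_of_le_of_lt (le_max_right _ _) hx
      have := (hx1 x hxx1.le).2
      exact (hh x (by linarith)).rpow_const (Or.inl (by linarith)))
    (fun x hx => by
      have hxx1 : x1 < x := lt_of_le_of_lt (le_max_left _ _) hx
      have e1 := (hx1 x hxx1.le).2
      have e2 := hgrow x hx
      have e3 : h x ^ ((s + 1) / 2) * h x ^ (-((s - 1) / 2) - 1) = 1 := by
        rw [← Real.rpow_add (by linarith)]
        have : (s + 1) / 2 + (-((s - 1) / 2) - 1) = 0 := by ring
        rw [this, Real.rpow_zero]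
      have e4 : 0 < h x ^ (-((s - 1) / 2) - 1) := Real.rpow_pos_of_pos (by linarith) _
      have e5 := mul_le_mul_of_nonneg_right e2 e4.le
      rw [mul_assoc, e3, mul_one] at e5
      nlinarith)
  have hxx1 : x1 < x := lt_of_le_of_lt (le_max_left _ _) hx
  have := (hx1 x hxx1.le).2
  have : 0 ≤ h x ^ (-((s - 1) / 2)) := Real.rpow_nonneg (by linarith) _
  linarith

/-! ### The radial system and unique continuation -/

/-- Backward Gronwall uniqueness for second-order equations. -/
theorem eq_zero_backward {k : ℕ} {K a b : ℝ} (ha : 0 < a) {z z1 g : ℝ → ℝ}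
    (hz : ∀ r ∈ Icc a b, HasDerivAt z (z1 r) r)
    (hz1 : ∀ r ∈ Icc a b, HasDerivAt z1 (-(k / r) * z1 r - g r) r)
    (hg : ∀ r ∈ Icc a b, |g r| ≤ K * |z r|) (hb : z b = 0) (hb1 : z1 b = 0) (hab : a ≤ b) :
    z a = 0 := by
  -- Chosen so that `(z² + z'²) exp(L r)` is nondecreasing: `1` absorbs `2 z z'`, `2k/a` the damping
  -- term on `[a, b]`, and `|K|` the term with `g`.
  set L := 1 + 2 * (k / a) + |K| with hL
  have hd : ∀ r ∈ Icc a b, HasDerivAt (fun r => (z r ^ 2 + z1 r ^ 2) * Real.exp (L * r))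
      (((2 : ℕ) * z r ^ (2 - 1) * z1 r + (2 : ℕ) * z1 r ^ (2 - 1) * (-(k / r) * z1 r - g r)) *
        Real.exp (L * r) + (z r ^ 2 + z1 r ^ 2) * (Real.exp (L * r) * (L * 1))) r := fun r hr =>
    (((hz r hr).pow 2).add ((hz1 r hr).pow 2)).mul
      (((hasDerivAt_id r).const_mul L).exp)
  have hmono : MonotoneOn (fun r => (z r ^ 2 + z1 r ^ 2) * Real.exp (L * r)) (Icc a b) := by
    refine monotoneOn_of_deriv_nonneg (convex_Icc a b)
      (fun r hr => (hd r hr).continuousAt.continuousWithinAt) ?_ ?_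
    · exact fun r hr =>
        (hd r (interior_subset hr)).differentiableAt.differentiableWithinAt
    · intro r hr
      have hr := interior_subset hr
      rw [(hd r hr).deriv]
      have hr0 : 0 < r := ha.trans_le hr.1
      have e1 : (k : ℝ) / r ≤ k / a := by gcongr; exact hr.1
      have e2 : (0 : ℝ) ≤ k / r := by positivity
      have e3 := hg r hr
      have e4 : |z1 r * g r| ≤ |K| * (|z r| * |z1 r|) := by
        rw [abs_mul]
        have : K * |z r| ≤ |K| * |z r| := by gcongr; exact le_abs_self K
        nlinarith [abs_nonneg (z1 r)]
      have e5 : 2 * (|z r| * |z1 r|) ≤ z r ^ 2 + z1 r ^ 2 := by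
        rw [← sq_abs (z r), ← sq_abs (z1 r)]
        nlinarith [sq_nonneg (|z r| - |z1 r|)]
      have e6 : |K| * (2 * (|z r| * |z1 r|)) ≤ |K| * (z r ^ 2 + z1 r ^ 2) := by gcongr
      have e7 := (abs_le.1 e4).2
      have e8 : (k : ℝ) / r * z1 r ^ 2 ≤ k / a * (z r ^ 2 + z1 r ^ 2) :=
        mul_le_mul e1 (by nlinarith [sq_nonneg (z r)]) (sq_nonneg _) (e2.trans e1)
      have key : 0 ≤ (2 * z r * z1 r + 2 * z1 r * (-(k / r) * z1 r - g r)) +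
          (z r ^ 2 + z1 r ^ 2) * L := by
        rw [hL]
        nlinarith [sq_nonneg (z r + z1 r)]
      have := mul_nonneg key (Real.exp_pos (L * r)).le
      push_cast
      simp only [pow_one, mul_one]
      linarith
  have := hmono (left_mem_Icc.2 hab) (right_mem_Icc.2 hab) hab
  simp only [hb, hb1] at this
  have h0 : z a ^ 2 + z1 a ^ 2 ≤ 0 := by
    have he := Real.exp_pos (L * a)
    by_contra hc
    push Not at hc
    have := mul_pos hc he
    simp at *
    linarith
  nlinarith [sq_nonneg (z a), sq_nonneg (z1 a)]

/-- `(u, v)` solves the radial system in dimension `k + 1` on `(0, ∞)`; the derivatives of `u` and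
`v` are `u1` and `v1`. -/
structure RadialSol (k : ℕ) (q β : ℝ) (u v u1 v1 : ℝ → ℝ) : Prop where
  hu : ∀ r, 0 < r → HasDerivAt u (u1 r) r
  hv : ∀ r, 0 < r → HasDerivAt v (v1 r) r
  hu1 : ∀ r, 0 < r → HasDerivAt u1 (-(k / r) * u1 r - coupledNonlinearity q β (u r) (v r)) r
  hv1 : ∀ r, 0 < r → HasDerivAt v1 (-(k / r) * v1 r - coupledNonlinearity q β (v r) (u r)) r

namespace RadialSol

variable {k : ℕ} {q β : ℝ} {u v u1 v1 : ℝ → ℝ}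

theorem swap (h : RadialSol k q β u v u1 v1) : RadialSol k q β v u v1 u1 :=
  ⟨h.hv, h.hu, h.hv1, h.hu1⟩

theorem neg_left (h : RadialSol k q β u v u1 v1) :
    RadialSol k q β (fun r => -u r) v (fun r => -u1 r) v1 where
  hu r hr := (h.hu r hr).neg
  hv := h.hv
  hu1 r hr := (h.hu1 r hr).neg.congr_deriv (by rw [coupledNonlinearity_neg_left]; ring)
  hv1 r hr := (h.hv1 r hr).congr_deriv (by rw [coupledNonlinearity_neg_right])

theorem neg_right (h : RadialSol k q β u v u1 v1) :
    RadialSol k q β u (fun r => -v r) u1 (fun r => -v1 r) :=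
  h.swap.neg_left.swap

theorem hasDerivAt_sub (h : RadialSol k q β u v u1 v1) {r : ℝ} (hr : 0 < r) :
    HasDerivAt (fun r => u r - v r) (u1 r - v1 r) r :=
  (h.hu r hr).sub (h.hv r hr)

theorem hasDerivAt_sub_deriv (h : RadialSol k q β u v u1 v1) {r : ℝ} (hr : 0 < r) :
    HasDerivAt (fun r => u1 r - v1 r) (-(k / r) * (u1 r - v1 r) -
      (coupledNonlinearity q β (u r) (v r) - coupledNonlinearity q β (v r) (u r))) r :=
  ((h.hu1 r hr).sub (h.hv1 r hr)).congr_deriv (by ring)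

/-- Unique continuation of the identity `u = v`. -/
theorem eq_of_eq_exterior (hq : -1 < q) (h : RadialSol k q β u v u1 v1) {R : ℝ}
    (hR : ∀ r, R < r → u r = v r) : ∀ r, 0 < r → u r = v r := by
  intro a ha
  set b := max a R + 1
  have hab : a < b := lt_of_le_of_lt (le_max_left _ _) (lt_add_one _)
  have hRb : R < b := lt_of_le_of_lt (le_max_right _ _) (lt_add_one _)
  have hpos : ∀ r ∈ Icc a b, 0 < r := fun r hr => ha.trans_le hr.1
  obtain ⟨M1, hM1⟩ := (isCompact_Icc (a := a) (b := b)).exists_bound_of_continuousOn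
    (f := u) (fun r hr => (h.hu r (hpos r hr)).continuousAt.continuousWithinAt)
  obtain ⟨M2, hM2⟩ := (isCompact_Icc (a := a) (b := b)).exists_bound_of_continuousOn
    (f := v) (fun r hr => (h.hv r (hpos r hr)).continuousAt.continuousWithinAt)
  have hb1 : u1 b - v1 b = 0 := by
    have e1 := h.hasDerivAt_sub (ha.trans hab)
    have e2 : HasDerivAt (fun r => u r - v r) 0 b := by
      refine (hasDerivAt_const b (0 : ℝ)).congr_of_eventuallyEq ?_
      filter_upwards [Ioi_mem_nhds hRb] with r hr
      rw [hR r hr, sub_self]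
    exact e1.unique e2
  have := eq_zero_backward (k := k) ha (fun r hr => h.hasDerivAt_sub (hpos r hr))
    (fun r hr => h.hasDerivAt_sub_deriv (hpos r hr))
    (fun r hr => abs_coupledNonlinearity_sub_swap_le hq
      ((hM1 r hr).trans (le_max_left M1 M2)) ((hM2 r hr).trans (le_max_right M1 M2)))
    (by simp [hR b hRb]) hb1 hab.le
  linarith

end RadialSol

/-! ### Exterior inequalities in dimension three -/

section ThreeDim

variable {R c s : ℝ} {z z1 g u : ℝ → ℝ}

theorem hasDerivAt_mul_self_three {r : ℝ} (hz : HasDerivAt z (z1 r) r) :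
    HasDerivAt (fun r => r * z r) (z r + r * z1 r) r :=
  ((hasDerivAt_id r).mul hz).congr_deriv (by simp)

theorem hasDerivAt_deriv_mul_self_three {r γ : ℝ} (hr : r ≠ 0) (hz : HasDerivAt z (z1 r) r)
    (hz1 : HasDerivAt z1 (-((2 : ℕ) / r) * z1 r - γ) r) :
    HasDerivAt (fun r => z r + r * z1 r) (-(r * γ)) r := by
  refine (hz.add ((hasDerivAt_id r).mul hz1)).congr_deriv ?_
  simp only [id]
  push_cast
  field_simp
  ring

/-- Positive radial functions with `-Δz ≥ c u^s z` in an exterior domain of `ℝ³`: `r z` is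
nondecreasing and concave, and `u` decays at the scaling rate along a sequence. -/
theorem superharmonic_three (hR : 0 ≤ R) (hc : 0 < c)
    (hz : ∀ r, R < r → HasDerivAt z (z1 r) r)
    (hz1 : ∀ r, R < r → HasDerivAt z1 (-((2 : ℕ) / r) * z1 r - g r) r)
    (hnn : ∀ r, R < r → 0 ≤ z r) (hu : ∀ r, R < r → 0 ≤ u r)
    (hg : ∀ r, R < r → c * u r ^ s * z r ≤ g r) :
    (∀ r, R < r → 0 ≤ z r + r * z1 r) ∧ (∀ r, 2 * R < r → r * z1 r ≤ z r) ∧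
      MonotoneOn (fun r => r * z r) (Ioi R) ∧
      ∀ r, 2 * R < r → 0 < z r → ∃ ξ ∈ Ioo r (2 * r), c * u ξ ^ s ≤ 2 / r ^ 2 := by
  have hg0 : ∀ r, R < r → 0 ≤ g r := fun r hr => le_trans (by
    have := hnn r hr; have := hu r hr; positivity) (hg r hr)
  have d1 : ∀ r, R < r → HasDerivAt (fun r => r * z r) (z r + r * z1 r) r := fun r hr =>
    hasDerivAt_mul_self_three (hz r hr)
  have d2 : ∀ r, R < r → HasDerivAt (fun r => z r + r * z1 r) (-(r * g r)) r := fun r hr =>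
    hasDerivAt_deriv_mul_self_three (by linarith) (hz r hr) (hz1 r hr)
  -- In `ℝ³` the function `r z` satisfies a one-dimensional equation without damping, so the case `k
  -- = 0` applies to it.
  have hp : ∀ r, R < r → 0 ≤ z r + r * z1 r :=
    deriv_nonneg_of_superharmonic (k := 0) zero_le_one hR d1
      (fun r hr => (d2 r hr).congr_deriv (by simp))
      (fun r hr => mul_nonneg (by linarith) (hnn r hr))
      (g := fun r => r * g r) (fun r hr => mul_nonneg (by linarith) (hg0 r hr))
  have hmono := monotoneOn_Ioi_of_hasDerivAt d1 hp
  have hanti := antitoneOn_Ioi_of_hasDerivAt d2 (fun r hr => by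
    have := mul_nonneg (by linarith : 0 ≤ r) (hg0 r hr); linarith)
  have hconc : ∀ r, 2 * R < r → r * z1 r ≤ z r := by
    intro r hr
    have hr0 : 0 < r := by linarith
    -- By concavity the slope of `r z` at `r` is at most its mean slope on `(r/2, r)`, hence at most
    -- `2 z r`; `r > 2R` keeps `r/2` in the domain.
    obtain ⟨η, hη, he⟩ := exists_hasDerivAt_eq_slope (fun r => r * z r) (fun r => z r + r * z1 r)
      (half_lt_self hr0) (fun x hx => (d1 x (by linarith [hx.1])).continuousAt.continuousWithinAt)
      (fun x hx => d1 x (by linarith [hx.1]))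
    have e1 := hanti (a := η) (by simp only [mem_Ioi]; linarith [hη.1]) (b := r)
      (by simp only [mem_Ioi]; linarith) hη.2.le
    simp only at e1 he
    rw [he, le_div_iff₀ (by linarith)] at e1
    have e2 : 0 ≤ r / 2 * z (r / 2) := mul_nonneg (by linarith) (hnn _ (by linarith))
    by_contra hcon
    push Not at hcon
    nlinarith
  refine ⟨hp, hconc, hmono, ?_⟩
  intro r hr hzr
  have hr0 : 0 < r := by linarith
  -- Over `(r, 2r)` the slope of `r z` loses `r · ξ g(ξ)`; it starts at no more than `2 z r` and
  -- ends nonnegative.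
  obtain ⟨ξ, hξ, he⟩ := exists_hasDerivAt_eq_slope (fun r => z r + r * z1 r) (fun r => -(r * g r))
    (by linarith : r < 2 * r)
    (fun x hx => (d2 x (by linarith [hx.1])).continuousAt.continuousWithinAt)
    (fun x hx => d2 x (by linarith [hx.1]))
  refine ⟨ξ, hξ, ?_⟩
  have hξ0 : 0 < ξ := hr0.trans hξ.1
  rw [eq_div_iff (by linarith)] at he
  have e1 := hp (2 * r) (by linarith)
  have e2 := hconc r hr
  have e3 : ξ * g ξ * r ≤ 2 * z r := by linarith
  have e4 := hg ξ (by linarith [hξ.1])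
  have e5 := hmono (a := r) (by simp only [mem_Ioi]; linarith) (b := ξ)
    (by simp only [mem_Ioi]; linarith [hξ.1]) hξ.1.le
  simp only at e5
  set A := c * u ξ ^ s with hA
  have hA0 : 0 ≤ A := by have := hu ξ (by linarith [hξ.1]); positivity
  rw [le_div_iff₀ (by positivity)]
  have e6 : A * (r * z r) ≤ A * (ξ * z ξ) := by gcongr
  have e7 : A * (ξ * z ξ) ≤ ξ * g ξ := by nlinarith
  have e8 : A * (r * z r) * r ≤ 2 * z r := by nlinarith
  have e9 : (A * r ^ 2) * z r ≤ 2 * z r := by nlinarith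
  exact le_of_mul_le_mul_right e9 hzr

/-- Turns the pointwise bound of `superharmonic_three` into the scaling rate: for `s = 2q + 2 = p -
1` the exponent is `2/(p-1)`. -/
theorem le_rpow_of_mul_rpow_le {c s a r : ℝ} (hc : 0 < c) (hs : 0 < s) (ha : 0 ≤ a) (hr : 0 < r)
    (h : c * a ^ s ≤ 2 / r ^ 2) : a ≤ (2 / c) ^ (1 / s) * r ^ (-(2 / s)) := by
  have h1 : a ^ s ≤ 2 / c * r ^ (-2 : ℝ) := by
    rw [Real.rpow_neg hr.le, ← div_eq_mul_inv, div_div, le_div_iff₀ (by positivity)]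
    rw [le_div_iff₀ (by positivity)] at h
    norm_cast
    linarith
  have h2 := Real.rpow_le_rpow (by positivity) h1 (by positivity : 0 ≤ 1 / s)
  rw [← Real.rpow_mul ha, mul_one_div_cancel hs.ne', Real.rpow_one,
    Real.mul_rpow (by positivity) (by positivity), ← Real.rpow_mul hr.le] at h2
  have e : (-2 : ℝ) * (1 / s) = -(2 / s) := by ring
  rwa [e] at h2

end ThreeDim

/-! ### The Pohozaev identity in dimension three -/

/-- The Pohozaev function in `ℝ³`. -/
noncomputable def pohozaev (q β : ℝ) (u v u1 v1 : ℝ → ℝ) (r : ℝ) : ℝ :=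
  r ^ 3 * ((u1 r ^ 2 + v1 r ^ 2) / 2 + couplingPotential q β (u r) (v r)) +
    3 / (2 * q + 4) * (r ^ 2 * (u r * u1 r + v r * v1 r))

namespace RadialSol

variable {q β : ℝ} {u v u1 v1 : ℝ → ℝ}

/-- The weight `3/(2q+4)` on the term `r² (u u' + v v')` is the one for which Euler's identity
cancels every contribution of the potential. -/
theorem hasDerivAt_pohozaev (hq : -1 < q) (h : RadialSol 2 q β u v u1 v1) {r : ℝ} (hr : 0 < r) :
    HasDerivAt (pohozaev q β u v u1 v1)
      ((3 / (2 * q + 4) - 1 / 2) * (r ^ 2 * (u1 r ^ 2 + v1 r ^ 2))) r := by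
  have hu := h.hu r hr
  have hv := h.hv r hr
  have hu1 := h.hu1 r hr
  have hv1 := h.hv1 r hr
  have := ((hasDerivAt_pow 3 r).mul ((((hu1.pow 2).add (hv1.pow 2)).div_const 2).add
    (hasDerivAt_couplingPotential (β := β) hq hu hv))).add
    (((hasDerivAt_pow 2 r).mul ((hu.mul hu1).add (hv.mul hv1))).const_mul (3 / (2 * q + 4)))
  refine this.congr_deriv ?_
  have h4 : 2 * q + 4 ≠ 0 := by linarith
  have key := coupledNonlinearity_mul_add (β := β) (s := u r) (t := v r) hq
  have hF : couplingPotential q β (u r) (v r) =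
      (u r * coupledNonlinearity q β (u r) (v r) + v r * coupledNonlinearity q β (v r) (u r)) /
        (2 * q + 4) := by
    rw [key]; field_simp
  simp only [Pi.add_apply, Pi.mul_apply, Pi.pow_apply]
  rw [hF]
  push_cast
  field_simp
  ring

/-- Pohozaev: a radial solution in `ℝ³` with the scaling decay along a sequence is constant. -/
theorem deriv_eq_zero_of_decay (hq : -1 < q) (hq1 : q < 1) (h : RadialSol 2 q β u v u1 v1)
    (cu : ContinuousOn u (Ici 0)) (cv : ContinuousOn v (Ici 0)) (cu1 : ContinuousOn u1 (Ici 0))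
    (cv1 : ContinuousOn v1 (Ici 0)) {K R a : ℝ} (ha : a < 0)
    (hdecay : ∀ r, R < r → ∃ ξ ∈ Ioo r (2 * r), pohozaev q β u v u1 v1 ξ ≤ K * r ^ a) :
    ∀ r, 0 < r → u1 r = 0 ∧ v1 r = 0 := by
  -- This is subcriticality: the coefficient is positive exactly when `q < 1`, that is `p < 5`.
  have hcoef : 0 < 3 / (2 * q + 4) - 1 / 2 := by
    rw [sub_pos, div_lt_div_iff₀ (by norm_num) (by linarith)]
    linarith
  have hmono := monotoneOn_Ioi_of_hasDerivAt (R := 0) (fun r hr => h.hasDerivAt_pohozaev hq hr)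
    (fun r _ => by positivity)
  have hcont : ContinuousWithinAt (pohozaev q β u v u1 v1) (Ici 0) 0 := by
    have m : (0 : ℝ) ∈ Ici 0 := self_mem_Ici
    have e4 : (0 : ℝ) ≤ 2 * q + 4 := by linarith
    have e2 : (0 : ℝ) ≤ q + 2 := by linarith
    have a4 : ∀ {w : ℝ → ℝ} {e : ℝ}, 0 ≤ e → ContinuousWithinAt w (Ici 0) 0 →
        ContinuousWithinAt (fun r => |w r| ^ e) (Ici 0) 0 := fun he hw =>
      hw.abs.rpow_const (Or.inr he)
    have cF : ContinuousWithinAt (fun r => couplingPotential q β (u r) (v r)) (Ici 0) 0 :=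
      (((a4 e4 (cu 0 m)).add (a4 e4 (cv 0 m))).div_const _).add
        (((a4 e2 (cu 0 m)).mul (a4 e2 (cv 0 m))).const_mul β |>.div_const _)
    have cr : ContinuousWithinAt (fun r : ℝ => r) (Ici 0) 0 := continuousWithinAt_id
    exact ((cr.pow 3).mul (((((cu1 0 m).pow 2).add ((cv1 0 m).pow 2)).div_const 2).add cF)).add
      (((cr.pow 2).mul (((cu 0 m).mul (cu1 0 m)).add ((cv 0 m).mul (cv1 0 m)))).const_mul _)
  have h0 : pohozaev q β u v u1 v1 0 = 0 := by simp [pohozaev]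
  have hnn : ∀ r, 0 < r → 0 ≤ pohozaev q β u v u1 v1 r := by
    intro r hr
    have ht : Filter.Tendsto (pohozaev q β u v u1 v1) (nhdsWithin 0 (Ioi 0)) (nhds 0) := by
      have := (hcont.mono Ioi_subset_Ici_self).tendsto
      rwa [h0] at this
    refine le_of_tendsto ht ?_
    filter_upwards [Ioo_mem_nhdsGT hr] with x hx
    exact hmono hx.1 hr hx.2.le
  -- Decay along a sequence is enough, since the function is monotone.
  have hle : ∀ r, 0 < r → pohozaev q β u v u1 v1 r ≤ 0 := by
    intro r hr
    have ht : Filter.Tendsto (fun x : ℝ => K * x ^ a) Filter.atTop (nhds (K * 0)) := by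
      have := tendsto_rpow_neg_atTop (y := -a) (by linarith)
      simp only [neg_neg] at this
      exact this.const_mul K
    rw [mul_zero] at ht
    refine ge_of_tendsto ht ?_
    filter_upwards [Filter.eventually_gt_atTop R, Filter.eventually_gt_atTop r] with x hxR hxr
    obtain ⟨ξ, hξ, hb⟩ := hdecay x hxR
    exact (hmono hr (hr.trans (hxr.trans hξ.1)) (hxr.trans hξ.1).le).trans hb
  intro r hr
  have e1 := h.hasDerivAt_pohozaev hq hr
  have e2 : HasDerivAt (pohozaev q β u v u1 v1) 0 r := by
    refine (hasDerivAt_const r (0 : ℝ)).congr_of_eventuallyEq ?_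
    filter_upwards [Ioi_mem_nhds hr] with x hx
    exact le_antisymm (hle x hx) (hnn x hx)
  have e3 := e1.unique e2
  have e4 : u1 r ^ 2 + v1 r ^ 2 = 0 := by
    exact (mul_eq_zero.1 ((mul_eq_zero.1 e3).resolve_left hcoef.ne')).resolve_left (by positivity)
  constructor <;> nlinarith [sq_nonneg (u1 r), sq_nonneg (v1 r)]

end RadialSol

namespace RadialSol

variable {q β : ℝ} {u v u1 v1 : ℝ → ℝ}

/-- With `m` of order `r^(-2/(p-1))`, each term of the Pohozaev function is bounded by a multiple of
`r m²`. The derivative of `v` is controlled only at a mean value point, hence the existential `ξ`.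
The two alternatives of `hctrl` serve the cases `β > -1` and `β ≤ -1`. -/
theorem exists_pohozaev_le (hq : -1 < q) (h : RadialSol 2 q β u v u1 v1) {R C : ℝ} (hR : 0 ≤ R)
    (hC : 0 ≤ C) (hv0 : ∀ r, R < r → 0 ≤ v r) (hvu : ∀ r, R < r → v r ≤ u r)
    (huC : ∀ r, R < r → u r ≤ C * r ^ (-(2 / (2 * q + 2))))
    (hctrl : ∀ r, R < r → |r * u1 r| ≤ u r ∨ |r * (u1 r - v1 r)| ≤ u r) :
    ∃ K, ∀ r, R < r → ∃ ξ ∈ Ioo r (2 * r),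
      pohozaev q β u v u1 v1 ξ ≤ K * r ^ (1 - 2 * (2 / (2 * q + 2))) := by
  set s := 2 * q + 2 with hs
  have hs0 : 0 < s := by linarith
  have ha0 : 0 < 3 / (2 * q + 4) := div_pos (by norm_num) (by linarith)
  set a := 3 / (2 * q + 4) with ha
  refine ⟨C ^ 2 * (13 + 8 * (1 + |β|) * C ^ s + 20 * a), fun r hr => ?_⟩
  have hr0 : 0 < r := by linarith
  set m := C * r ^ (-(2 / s)) with hm
  have hm0 : 0 ≤ m := by positivity
  have hum : ∀ x, r ≤ x → u x ≤ m := fun x hx => (huC x (by linarith)).trans (by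
    rw [hm]
    exact mul_le_mul_of_nonneg_left
      (Real.rpow_le_rpow_of_nonpos hr0 hx (by rw [neg_nonpos]; positivity)) hC)
  have d1 : ∀ x, R < x → HasDerivAt (fun x => x * v x) (v x + x * v1 x) x := fun x hx =>
    hasDerivAt_mul_self_three (h.hv x (by linarith))
  -- At this point `v ξ + ξ v'(ξ) = 2 v(2r) - v(r)`, so bounds on `v` alone bound `ξ v'(ξ)`.
  obtain ⟨ξ, hξ, he⟩ := exists_hasDerivAt_eq_slope (fun x => x * v x) (fun x => v x + x * v1 x)
    (by linarith : r < 2 * r)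
    (fun x hx => (d1 x (by linarith [hx.1])).continuousAt.continuousWithinAt)
    (fun x hx => d1 x (by linarith [hx.1]))
  refine ⟨ξ, hξ, ?_⟩
  obtain ⟨hξ1, hξ2⟩ := hξ
  have hξ0 : 0 < ξ := by linarith
  have he2 : v ξ + ξ * v1 ξ = 2 * v (2 * r) - v r := by
    rw [he, div_eq_iff (by linarith)]; ring
  have b1 := hv0 (2 * r) (by linarith)
  have b2 := (hvu (2 * r) (by linarith)).trans (hum (2 * r) (by linarith))
  have b3 := hv0 r hr
  have b4 := (hvu r hr).trans (hum r le_rfl)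
  have b5 := hv0 ξ (by linarith)
  have b6 := hvu ξ (by linarith)
  have b7 := hum ξ hξ1.le
  have w1 : |ξ * v1 ξ| ≤ 2 * m := abs_le.2 ⟨by linarith, by linarith⟩
  have w2 : |ξ * u1 ξ| ≤ 3 * m := by
    rcases hctrl ξ (by linarith) with hc | hc
    · linarith
    · have : ξ * u1 ξ = ξ * (u1 ξ - v1 ξ) + ξ * v1 ξ := by ring
      rw [this]
      exact (abs_add_le _ _).trans (by linarith)
  have hF : couplingPotential q β (u ξ) (v ξ) ≤ (1 + |β|) * (m ^ s * m ^ 2) :=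
    (le_abs_self _).trans (abs_couplingPotential_le hq
      (by rw [abs_of_nonneg (b5.trans b6)]; exact b7) (by rw [abs_of_nonneg b5]; linarith))
  have hms : m ^ s = C ^ s * (r ^ 2)⁻¹ := by
    rw [hm, Real.mul_rpow hC (by positivity), ← Real.rpow_mul hr0.le]
    have : -(2 / s) * s = -2 := by field_simp
    rw [this, Real.rpow_neg hr0.le]
    norm_cast
  have hrm : r * m ^ 2 = C ^ 2 * r ^ (1 - 2 * (2 / s)) := by
    rw [hm, mul_pow, ← Real.rpow_natCast (r ^ (-(2 / s))), ← Real.rpow_mul hr0.le, mul_left_comm]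
    nth_rewrite 1 [← Real.rpow_one r]
    rw [← Real.rpow_add hr0]
    congr 2
    push_cast; ring
  have t1 : ξ * (((ξ * u1 ξ) ^ 2 + (ξ * v1 ξ) ^ 2) / 2) ≤ 2 * r * ((9 * m ^ 2 + 4 * m ^ 2) / 2) := by
    have q1 : (ξ * u1 ξ) ^ 2 ≤ 9 * m ^ 2 := by
      rw [← sq_abs]; nlinarith [abs_nonneg (ξ * u1 ξ)]
    have q2 : (ξ * v1 ξ) ^ 2 ≤ 4 * m ^ 2 := by
      rw [← sq_abs]; nlinarith [abs_nonneg (ξ * v1 ξ)]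
    gcongr
  have t2 : ξ ^ 3 * couplingPotential q β (u ξ) (v ξ) ≤
      (2 * r) ^ 3 * ((1 + |β|) * (m ^ s * m ^ 2)) := by
    calc _ ≤ ξ ^ 3 * ((1 + |β|) * (m ^ s * m ^ 2)) := by gcongr
      _ ≤ _ := by gcongr
  have t3 : ξ * (u ξ * (ξ * u1 ξ) + v ξ * (ξ * v1 ξ)) ≤ 2 * r * (5 * m ^ 2) := by
    have q1 : u ξ * (ξ * u1 ξ) ≤ m * (3 * m) := by
      calc u ξ * (ξ * u1 ξ) ≤ u ξ * |ξ * u1 ξ| :=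
            mul_le_mul_of_nonneg_left (le_abs_self _) (b5.trans b6)
        _ ≤ _ := mul_le_mul b7 w2 (abs_nonneg _) hm0
    have q2 : v ξ * (ξ * v1 ξ) ≤ m * (2 * m) := by
      calc v ξ * (ξ * v1 ξ) ≤ v ξ * |ξ * v1 ξ| :=
            mul_le_mul_of_nonneg_left (le_abs_self _) b5
        _ ≤ _ := mul_le_mul (by linarith) w1 (abs_nonneg _) hm0
    calc _ ≤ ξ * (5 * m ^ 2) := mul_le_mul_of_nonneg_left (by linarith) hξ0.le
      _ ≤ _ := by gcongr
  have t4 : (2 * r) ^ 3 * ((1 + |β|) * (m ^ s * m ^ 2)) =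
      8 * (1 + |β|) * C ^ s * (r * m ^ 2) := by
    rw [hms]; field_simp; ring
  rw [t4] at t2
  have hP : pohozaev q β u v u1 v1 ξ = ξ * (((ξ * u1 ξ) ^ 2 + (ξ * v1 ξ) ^ 2) / 2) +
      ξ ^ 3 * couplingPotential q β (u ξ) (v ξ) +
      a * (ξ * (u ξ * (ξ * u1 ξ) + v ξ * (ξ * v1 ξ))) := by
    rw [pohozaev]; ring
  rw [hP]
  have t5 := mul_le_mul_of_nonneg_left t3 ha0.le
  have : C ^ 2 * (13 + 8 * (1 + |β|) * C ^ s + 20 * a) * r ^ (1 - 2 * (2 / s)) =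
      (13 + 8 * (1 + |β|) * C ^ s + 20 * a) * (r * m ^ 2) := by
    rw [hrm]; ring
  rw [this]
  have t6 : 0 ≤ a * (r * m ^ 2) := by positivity
  nlinarith

/-- The bound on the Pohozaev function tends to zero since `1 - 4/(p-1) < 0` for `p < 5`. The
solution is then constant, and a nonnegative constant below a decaying function is zero. -/
theorem eq_zero_of_decay_three (hq : -1 < q) (hq1 : q < 1) (h : RadialSol 2 q β u v u1 v1)
    (cu : ContinuousOn u (Ici 0)) (cv : ContinuousOn v (Ici 0)) (cu1 : ContinuousOn u1 (Ici 0))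
    (cv1 : ContinuousOn v1 (Ici 0)) {R C : ℝ} (hR : 0 ≤ R) (hC : 0 ≤ C)
    (hv0 : ∀ r, R < r → 0 ≤ v r) (hvu : ∀ r, R < r → v r ≤ u r)
    (huC : ∀ r, R < r → u r ≤ C * r ^ (-(2 / (2 * q + 2))))
    (hctrl : ∀ r, R < r → |r * u1 r| ≤ u r ∨ |r * (u1 r - v1 r)| ≤ u r) :
    ∀ r, 0 < r → u r = 0 ∧ v r = 0 := by
  obtain ⟨K, hK⟩ := h.exists_pohozaev_le hq hR hC hv0 hvu huC hctrl
  have hneg : 1 - 2 * (2 / (2 * q + 2)) < 0 := by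
    have : 1 < 2 * (2 / (2 * q + 2)) := by
      rw [← mul_div_assoc, lt_div_iff₀ (by linarith)]; linarith
    linarith
  have hd := h.deriv_eq_zero_of_decay hq hq1 cu cv cu1 cv1 hneg hK
  have ht : Filter.Tendsto (fun r : ℝ => C * r ^ (-(2 / (2 * q + 2)))) Filter.atTop
      (nhds (C * 0)) :=
    (tendsto_rpow_neg_atTop (div_pos two_pos (by linarith))).const_mul C
  rw [mul_zero] at ht
  have hzero : ∀ {w w1 : ℝ → ℝ}, (∀ r, 0 < r → HasDerivAt w (w1 r) r) → (∀ r, 0 < r → w1 r = 0) →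
      (∀ r, R < r → 0 ≤ w r) → (∀ r, R < r → w r ≤ C * r ^ (-(2 / (2 * q + 2)))) →
      ∀ r, 0 < r → w r = 0 := by
    intro w w1 hw hw1 hw0 hwC r hr
    have m1 := monotoneOn_Ioi_of_hasDerivAt hw (fun r hr => (hw1 r hr).ge)
    have m2 := antitoneOn_Ioi_of_hasDerivAt hw (fun r hr => (hw1 r hr).le)
    have ev : ∀ᶠ x in Filter.atTop, w x = w r := by
      filter_upwards [Filter.eventually_gt_atTop r] with x hx
      exact le_antisymm (m2 hr (hr.trans hx) hx.le) (m1 hr (hr.trans hx) hx.le)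
    refine le_antisymm ?_ ?_
    · refine ge_of_tendsto ht ?_
      filter_upwards [ev, Filter.eventually_gt_atTop R] with x hx hxR
      exact hx ▸ hwC x hxR
    · obtain ⟨x, hx, hxR⟩ := (ev.and (Filter.eventually_gt_atTop R)).exists
      exact hx ▸ hw0 x hxR
  intro r hr
  exact ⟨hzero h.hu (fun r hr => (hd r hr).1) (fun r hr => (hv0 r hr).trans (hvu r hr)) huC r hr,
    hzero h.hv (fun r hr => (hd r hr).2) hv0 (fun r hr => (hvu r hr).trans (huC r hr)) r hr⟩

end RadialSol

/-! ### Liouville theorems for ordered solutions in exterior domains -/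

namespace RadialSol

variable {k : ℕ} {q β : ℝ} {u v u1 v1 : ℝ → ℝ}

/-- Ordered nonnegative solutions in an exterior domain vanish there if `β > -1`. -/
theorem eq_zero_exterior (hk : k ≤ 2) (hq : -1 < q) (h : RadialSol k q β u v u1 v1)
    (h3 : k = 2 → q < 1 ∧ ContinuousOn u (Ici 0) ∧ ContinuousOn v (Ici 0) ∧
      ContinuousOn u1 (Ici 0) ∧ ContinuousOn v1 (Ici 0))
    {R : ℝ} (hR : 0 ≤ R) (hv0 : ∀ r, R < r → 0 ≤ v r) (hvu : ∀ r, R < r → v r ≤ u r)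
    (hβ : -1 < β) : ∀ r, R < r → u r = 0 := by
  have hc : 0 < min 1 (1 + β) := lt_min one_pos (by linarith)
  have hs : 0 < 2 * q + 2 := by linarith
  have hu0 : ∀ r, R < r → 0 ≤ u r := fun r hr => (hv0 r hr).trans (hvu r hr)
  have hg : ∀ r, R < r → min 1 (1 + β) * u r ^ (2 * q + 2) * u r ≤
      coupledNonlinearity q β (u r) (v r) := fun r hr =>
    le_coupledNonlinearity hq (hv0 r hr) (hvu r hr)
  rcases Nat.lt_or_ge k 2 with hk2 | hk2
  · exact eq_zero_of_exterior_lowDim (Nat.lt_succ_iff.1 hk2) hR hc hs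
      (fun r hr => h.hu r (hR.trans_lt hr)) (fun r hr => h.hu1 r (hR.trans_lt hr)) hu0 hg
  obtain rfl : k = 2 := le_antisymm hk hk2
  obtain ⟨hq1, cu, cv, cu1, cv1⟩ := h3 rfl
  obtain ⟨s1, s2, s3, s4⟩ := superharmonic_three hR hc (fun r hr => h.hu r (hR.trans_lt hr))
    (fun r hr => h.hu1 r (hR.trans_lt hr)) hu0 hu0 hg
  intro r0 hr0
  by_contra hne
  have hpos : 0 < u r0 := lt_of_le_of_ne (hu0 r0 hr0) (Ne.symm hne)
  have hr00 : 0 < r0 := hR.trans_lt hr0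
  -- The extra factor `2` in `C` moves the bound from `ξ < 2r` back to `r`, using that `r u` is
  -- nondecreasing.
  refine hne (h.eq_zero_of_decay_three hq hq1 cu cv cu1 cv1 (R := 2 * r0)
    (C := 2 * (2 / min 1 (1 + β)) ^ (1 / (2 * q + 2))) (by linarith) (by positivity)
    (fun r hr => hv0 r (by linarith)) (fun r hr => hvu r (by linarith)) (fun r hr => ?_)
    (fun r hr => Or.inl ?_) r0 hr00).1
  · have hr' : 0 < r := by linarith
    have hm := s3 (a := r0) hr0 (b := r) (by simp only [mem_Ioi]; linarith) (by linarith)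
    obtain ⟨ξ, hξ, hb⟩ := s4 r (by linarith)
      (pos_of_mul_pos_right ((mul_pos hr00 hpos).trans_le hm) hr'.le)
    have hb' := le_rpow_of_mul_rpow_le hc hs (hu0 ξ (by linarith [hξ.1])) hr' hb
    have hm2 := s3 (a := r) (by simp only [mem_Ioi]; linarith) (b := ξ)
      (by simp only [mem_Ioi]; linarith [hξ.1]) hξ.1.le
    simp only at hm2
    have : r * u r ≤ r * (2 * u ξ) := by
      nlinarith [hξ.2, hu0 ξ (by linarith [hξ.1])]
    have := le_of_mul_le_mul_left this hr'
    linarith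
  · have e1 := s1 r (by linarith)
    have e2 := s2 r (by linarith)
    exact abs_le.2 ⟨by linarith, e2⟩

/-- The components of ordered nonnegative solutions in an exterior domain coincide there if
`β ≤ -1`. -/
theorem eq_exterior (hk : k ≤ 2) (hq : -1 < q) (h : RadialSol k q β u v u1 v1)
    (h3 : k = 2 → q < 1 ∧ ContinuousOn u (Ici 0) ∧ ContinuousOn v (Ici 0) ∧
      ContinuousOn u1 (Ici 0) ∧ ContinuousOn v1 (Ici 0))
    {R : ℝ} (hR : 0 ≤ R) (hv0 : ∀ r, R < r → 0 ≤ v r) (hvu : ∀ r, R < r → v r ≤ u r)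
    (hβ : β ≤ -1) : ∀ r, R < r → u r = v r := by
  have hs : 0 < 2 * q + 2 := by linarith
  have hu0 : ∀ r, R < r → 0 ≤ u r := fun r hr => (hv0 r hr).trans (hvu r hr)
  have hz0 : ∀ r, R < r → 0 ≤ u r - v r := fun r hr => sub_nonneg.2 (hvu r hr)
  have hg : ∀ r, R < r → 1 * u r ^ (2 * q + 2) * (u r - v r) ≤
      coupledNonlinearity q β (u r) (v r) - coupledNonlinearity q β (v r) (u r) := fun r hr => by
    rw [one_mul]
    exact le_coupledNonlinearity_sub_swap hq hβ (hv0 r hr) (hvu r hr)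
  have hz : ∀ r, R < r → HasDerivAt (fun r => u r - v r) (u1 r - v1 r) r := fun r hr =>
    h.hasDerivAt_sub (hR.trans_lt hr)
  have hz1 := fun r hr => h.hasDerivAt_sub_deriv (r := r) (hR.trans_lt hr)
  rcases Nat.lt_or_ge k 2 with hk2 | hk2
  · intro r hr
    refine sub_eq_zero.1 (eq_zero_of_exterior_lowDim (Nat.lt_succ_iff.1 hk2) hR one_pos hs hz hz1
      hz0 (fun r hr => le_trans ?_ (hg r hr)) r hr)
    have e1 := hz0 r hr
    have e2 := hv0 r hr
    have : u r - v r ≤ u r := by linarith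
    gcongr
  obtain rfl : k = 2 := le_antisymm hk hk2
  obtain ⟨hq1, cu, cv, cu1, cv1⟩ := h3 rfl
  obtain ⟨s1, s2, s3, s4⟩ := superharmonic_three hR one_pos hz hz1 hz0 hu0 hg
  -- Decay along a sequence does not by itself control `v` in between; subharmonicity of `v`, as
  -- convexity of `r v`, interpolates.
  have hconv : ConvexOn ℝ (Ioi R) (fun r => r * v r) := by
    have d1 : ∀ r, R < r → HasDerivAt (fun r => r * v r) (v r + r * v1 r) r := fun r hr =>
      hasDerivAt_mul_self_three (h.hv r (hR.trans_lt hr))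
    refine convexOn_of_hasDerivWithinAt2_nonneg (convex_Ioi R)
      (f' := fun r => v r + r * v1 r)
      (f'' := fun r => -(r * coupledNonlinearity q β (v r) (u r)))
      (fun r hr => (d1 r hr).continuousAt.continuousWithinAt) ?_ ?_ ?_
    all_goals rw [interior_Ioi]; intro r hr
    · exact (d1 r hr).hasDerivWithinAt
    · exact (hasDerivAt_deriv_mul_self_three (hR.trans_lt hr).ne' (h.hv r (hR.trans_lt hr))
        (h.hv1 r (hR.trans_lt hr))).hasDerivWithinAt
    · have e1 := coupledNonlinearity_nonpos hq hβ (hv0 r hr) (hvu r hr)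
      have e2 : 0 < r := hR.trans_lt hr
      nlinarith
  intro r0 hr0
  by_contra hne
  have hpos : 0 < u r0 - v r0 := lt_of_le_of_ne (hz0 r0 hr0) (Ne.symm (sub_ne_zero.2 hne))
  have hr00 : 0 < r0 := hR.trans_lt hr0
  set α := 2 / (2 * q + 2) with hα
  have hα0 : 0 < α := by positivity
  set C : ℝ := (2 / 1) ^ (1 / (2 * q + 2)) with hC
  have hC0 : 0 < C := by positivity
  have hpt : ∀ r, 2 * r0 < r → ∃ ξ ∈ Ioo r (2 * r), u ξ ≤ C * r ^ (-α) := by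
    intro r hr
    have hm := s3 (a := r0) hr0 (b := r) (by simp only [mem_Ioi]; linarith) (by linarith)
    obtain ⟨ξ, hξ, hb⟩ := s4 r (by linarith)
      (pos_of_mul_pos_right ((mul_pos hr00 hpos).trans_le hm) (by linarith))
    exact ⟨ξ, hξ, le_rpow_of_mul_rpow_le one_pos hs (hu0 ξ (by linarith [hξ.1])) (by linarith) hb⟩
  -- Good points `ξ` in `(r/2, r)` and `η` in `(r, 2r)` surround `r`. Monotonicity of `r (u - v)`
  -- towards `η` and convexity of `r v` between `ξ` and `η` bound `u - v` and `v` by `2M` each; `2 ^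
  -- α` comes from starting at `r/2`.
  have hbound : ∀ r, 4 * r0 < r → u r ≤ (4 * (C * 2 ^ α)) * r ^ (-α) := by
    intro r hr
    have hr' : 0 < r := by linarith
    obtain ⟨ξ, ⟨hξ1, hξ2⟩, hξb⟩ := hpt (r / 2) (by linarith)
    obtain ⟨η, ⟨hη1, hη2⟩, hηb⟩ := hpt r (by linarith)
    have e0 : (r / 2) ^ (-α) = 2 ^ α * r ^ (-α) := by
      rw [Real.div_rpow hr'.le zero_le_two, Real.rpow_neg zero_le_two, div_inv_eq_mul, mul_comm]
    rw [e0] at hξb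
    have e1 : (1 : ℝ) ≤ 2 ^ α := Real.one_le_rpow one_le_two hα0.le
    have e2 : C * r ^ (-α) ≤ C * (2 ^ α * r ^ (-α)) := by
      have : 0 < r ^ (-α) := by positivity
      gcongr
      nlinarith
    set M := C * (2 ^ α * r ^ (-α)) with hM
    have hM0 : 0 ≤ M := by positivity
    have hηb' := hηb.trans e2
    have f1 := hvu ξ (by linarith)
    have f2 := hvu η (by linarith)
    have f3 := hv0 ξ (by linarith)
    have f4 := hv0 η (by linarith)
    have hzr := s3 (a := r) (by simp only [mem_Ioi]; linarith) (b := η)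
      (by simp only [mem_Ioi]; linarith) hη1.le
    simp only at hzr
    have hz2 : r * (u r - v r) ≤ r * (2 * M) := by nlinarith
    have hvr := hconv.le_max_of_mem_Icc (x := ξ) (y := η) (z := r)
      (by simp only [mem_Ioi]; linarith) (by simp only [mem_Ioi]; linarith)
      ⟨by linarith, by linarith⟩
    have hv2 : r * v r ≤ r * (2 * M) := hvr.trans (max_le (by nlinarith) (by nlinarith))
    have g1 := le_of_mul_le_mul_left hz2 hr'
    have g2 := le_of_mul_le_mul_left hv2 hr'
    calc u r ≤ 4 * M := by linarith
      _ = _ := by rw [hM]; ring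
  have h0 := h.eq_zero_of_decay_three hq hq1 cu cv cu1 cv1 (R := 4 * r0)
    (C := 4 * (C * 2 ^ α)) (by linarith) (by positivity)
    (fun r hr => hv0 r (by linarith)) (fun r hr => hvu r (by linarith)) hbound
    (fun r hr => Or.inr ?_) r0 hr00
  · exact hne (h0.1.trans h0.2.symm)
  · have e1 := s1 r (by linarith)
    have e2 := s2 r (by linarith)
    have e3 := hv0 r (by linarith)
    exact abs_le.2 ⟨by linarith, by linarith⟩

end RadialSol

/-! ### Zero numbers and eventual signs -/

/-- `f` does not change sign on `(R, ∞)`. -/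
def ConstSign (R : ℝ) (f : ℝ → ℝ) : Prop :=
  (∀ r, R < r → 0 ≤ f r) ∨ (∀ r, R < r → f r ≤ 0)

theorem ConstSign.neg {R : ℝ} {f : ℝ → ℝ} (h : ConstSign R f) : ConstSign R (fun r => -f r) :=
  h.symm.imp (fun h r hr => neg_nonneg.2 (h r hr)) (fun h r hr => neg_nonpos.2 (h r hr))

theorem ConstSign.mono {R R' : ℝ} {f : ℝ → ℝ} (h : ConstSign R f) (hR : R ≤ R') :
    ConstSign R' f :=
  h.imp (fun h r hr => h r (hR.trans_lt hr)) (fun h r hr => h r (hR.trans_lt hr))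

theorem zeroNumber_le_of_strictMono {J J' : Set ℝ} {f f' g : ℝ → ℝ} (hg : StrictMono g)
    (hJ : ∀ x ∈ J, g x ∈ J') (hf : ∀ x ∈ J, f x = f' (g x)) :
    zeroNumber J f ≤ zeroNumber J' f' := by
  refine iSup₂_le fun j ⟨x, hx, hxJ, hxf⟩ => ?_
  refine le_iSup₂_of_le j ⟨g ∘ x, hg.comp hx, fun i => hJ _ (hxJ i), fun i => ?_⟩ le_rfl
  simpa only [Function.comp, ← hf _ (hxJ _)] using hxf i

/-- Used for restriction from `[0, ∞)` to `(0, ∞)` and for translated half-lines in `ℝ`. -/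
theorem InClassK.of_strictMono {C₁ C₂ C₃ C₄ : ℝ≥0} {J J' : Set ℝ} {u v u' v' g : ℝ → ℝ}
    (h : InClassK C₁ C₂ C₃ C₄ J' u' v') (hg : StrictMono g) (hJ : ∀ x ∈ J, g x ∈ J')
    (hu : ∀ x ∈ J, u x = u' (g x)) (hv : ∀ x ∈ J, v x = v' (g x)) :
    InClassK C₁ C₂ C₃ C₄ J u v := by
  obtain ⟨h1, h2, h3, h4⟩ := h
  refine ⟨le_trans ?_ h1, le_trans ?_ h2, le_trans ?_ h3, le_trans ?_ h4⟩ <;>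
    refine ENat.toENNReal_le.2 (zeroNumber_le_of_strictMono hg hJ fun x hx => ?_)
  · exact hu x hx
  · exact hv x hx
  · rw [hu x hx, hv x hx]
  · rw [hu x hx, hv x hx]

/-- Functions with finitely many sign changes eventually do not change sign. -/
theorem exists_constSign {f : ℝ → ℝ} (h : zeroNumber (Ioi 0) f ≠ ⊤) :
    ∃ R, ConstSign R f := by
  by_contra hcon
  simp only [ConstSign, not_exists, not_or, not_forall, not_le, exists_prop] at hcon
  -- Without an eventual sign, every point where `f ≠ 0` has a later one of opposite sign; iteration
  -- gives arbitrarily long alternating chains.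
  have step : ∀ x : {x : ℝ // 0 < x ∧ f x ≠ 0}, ∃ y : {x : ℝ // 0 < x ∧ f x ≠ 0},
      (x : ℝ) < y ∧ f x * f y < 0 := by
    rintro ⟨x, hx, hfx⟩
    obtain ⟨⟨y, hy, hfy⟩, ⟨y', hy', hfy'⟩⟩ := hcon x
    rcases hfx.lt_or_gt with hlt | hgt
    · exact ⟨⟨y', hx.trans hy', hfy'.ne'⟩, hy', mul_neg_of_neg_of_pos hlt hfy'⟩
    · exact ⟨⟨y, hx.trans hy, hfy.ne⟩, hy, mul_neg_of_pos_of_neg hgt hfy⟩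
  choose nx hnx using step
  obtain ⟨⟨x0, hx0, hfx0⟩, -⟩ := hcon 0
  let sq : ℕ → {x : ℝ // 0 < x ∧ f x ≠ 0} := fun n =>
    Nat.rec ⟨x0, hx0, hfx0.ne⟩ (fun _ x => nx x) n
  have hmono : StrictMono (fun n : ℕ => (sq n).1) := 
    strictMono_nat_of_lt_succ (f := fun n : ℕ => (sq n).1) fun n => (hnx (sq n)).1
  have hle : ∀ j : ℕ, (j : ℕ∞) ≤ zeroNumber (Ioi 0) f := fun j =>
    le_iSup₂_of_le j ⟨fun i : Fin (j + 1) => (sq i).1, fun a b hab => hmono hab, fun i => (sq i).2.1,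
      fun i => (hnx (sq i)).2⟩ le_rfl
  obtain ⟨m, hm⟩ := ENat.ne_top_iff_exists.1 h
  have := hle (m + 1)
  rw [← hm] at this
  have := Nat.cast_le.1 this
  omega

theorem InClassK.exists_constSign {C₁ C₂ C₃ C₄ : ℝ≥0} {u v : ℝ → ℝ}
    (h : InClassK C₁ C₂ C₃ C₄ (Ioi 0) u v) :
    ∃ R, 0 ≤ R ∧ ConstSign R u ∧ ConstSign R v ∧ ConstSign R (fun r => u r - v r) ∧
      ConstSign R (fun r => u r + v r) := by
  have key : ∀ {C : ℝ≥0} {f : ℝ → ℝ}, (zeroNumber (Ioi 0) f : ℝ≥0∞) ≤ C →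
      ∃ R, ConstSign R f := fun hC =>
    _root_.exists_constSign fun htop => by
      rw [htop, ENat.toENNReal_top, top_le_iff] at hC
      exact ENNReal.coe_ne_top hC
  obtain ⟨h1, h2, h3, h4⟩ := h
  obtain ⟨R1, k1⟩ := key h1
  obtain ⟨R2, k2⟩ := key h2
  obtain ⟨R3, k3⟩ := key h3
  obtain ⟨R4, k4⟩ := key h4
  refine ⟨max 0 (max (max R1 R2) (max R3 R4)), le_max_left _ _, k1.mono ?_, k2.mono ?_,
    k3.mono ?_, k4.mono ?_⟩ <;> simp

/-! ### Reduction to ordered solutions by symmetry -/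

namespace RadialSol

variable {k : ℕ} {q β : ℝ} {u v u1 v1 : ℝ → ℝ}

/-- If both components vanish outside a ball, then both `u = v` and `u = -v` hold there; continuing
the two identities inward gives zero. -/
theorem dichotomy_of_ordered (hk : k ≤ 2) (hq : -1 < q) (h : RadialSol k q β u v u1 v1)
    (h3 : k = 2 → q < 1 ∧ ContinuousOn u (Ici 0) ∧ ContinuousOn v (Ici 0) ∧
      ContinuousOn u1 (Ici 0) ∧ ContinuousOn v1 (Ici 0))
    {R : ℝ} (hR : 0 ≤ R) (hv0 : ∀ r, R < r → 0 ≤ v r) (hvu : ∀ r, R < r → v r ≤ u r) :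
    (-1 < β → ∀ r, 0 < r → u r = 0 ∧ v r = 0) ∧
      (β ≤ -1 → (∀ r, 0 < r → u r = v r) ∨ (∀ r, 0 < r → u r = -v r)) := by
  refine ⟨fun hβ r hr => ?_, fun hβ =>
    Or.inl (h.eq_of_eq_exterior hq (h.eq_exterior hk hq h3 hR hv0 hvu hβ))⟩
  have hu := h.eq_zero_exterior hk hq h3 hR hv0 hvu hβ
  have hv : ∀ r, R < r → v r = 0 := fun r hr =>
    le_antisymm ((hvu r hr).trans (hu r hr).le) (hv0 r hr)
  have e1 := h.eq_of_eq_exterior hq (fun r hr => (hu r hr).trans (hv r hr).symm) r hr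
  have e2 := h.neg_right.eq_of_eq_exterior hq (R := R) (fun r hr => by simp [hu r hr, hv r hr]) r hr
  constructor <;> linarith

theorem dichotomy_of_nonneg (hk : k ≤ 2) (hq : -1 < q) (h : RadialSol k q β u v u1 v1)
    (h3 : k = 2 → q < 1 ∧ ContinuousOn u (Ici 0) ∧ ContinuousOn v (Ici 0) ∧
      ContinuousOn u1 (Ici 0) ∧ ContinuousOn v1 (Ici 0))
    {R : ℝ} (hR : 0 ≤ R) (hu0 : ∀ r, R < r → 0 ≤ u r) (hv0 : ∀ r, R < r → 0 ≤ v r)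
    (hs : ConstSign R (fun r => u r - v r)) :
    (-1 < β → ∀ r, 0 < r → u r = 0 ∧ v r = 0) ∧
      (β ≤ -1 → (∀ r, 0 < r → u r = v r) ∨ (∀ r, 0 < r → u r = -v r)) := by
  rcases hs with hs | hs
  · exact h.dichotomy_of_ordered hk hq h3 hR hv0 fun r hr => sub_nonneg.1 (hs r hr)
  · obtain ⟨c1, c2⟩ := h.swap.dichotomy_of_ordered hk hq
      (fun hk => ⟨(h3 hk).1, (h3 hk).2.2.1, (h3 hk).2.1, (h3 hk).2.2.2.2, (h3 hk).2.2.2.1⟩)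
      hR hu0 fun r hr => sub_nonpos.1 (hs r hr)
    exact ⟨fun hβ r hr => (c1 hβ r hr).symm, fun hβ => (c2 hβ).imp
      (fun hh r hr => (hh r hr).symm) (fun hh r hr => by linarith [hh r hr])⟩

/-- Reflecting `u` exchanges `u - v` and `u + v` up to sign, which is why the signs of both are
needed. -/
theorem dichotomy_of_right_nonneg (hk : k ≤ 2) (hq : -1 < q) (h : RadialSol k q β u v u1 v1)
    (h3 : k = 2 → q < 1 ∧ ContinuousOn u (Ici 0) ∧ ContinuousOn v (Ici 0) ∧
      ContinuousOn u1 (Ici 0) ∧ ContinuousOn v1 (Ici 0))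
    {R : ℝ} (hR : 0 ≤ R) (hu : ConstSign R u) (hv0 : ∀ r, R < r → 0 ≤ v r)
    (hs : ConstSign R (fun r => u r - v r)) (hs' : ConstSign R (fun r => u r + v r)) :
    (-1 < β → ∀ r, 0 < r → u r = 0 ∧ v r = 0) ∧
      (β ≤ -1 → (∀ r, 0 < r → u r = v r) ∨ (∀ r, 0 < r → u r = -v r)) := by
  rcases hu with hu | hu
  · exact h.dichotomy_of_nonneg hk hq h3 hR hu hv0 hs
  · obtain ⟨c1, c2⟩ := h.neg_left.dichotomy_of_nonneg hk hq
      (fun hk => ⟨(h3 hk).1, (h3 hk).2.1.neg, (h3 hk).2.2.1, (h3 hk).2.2.2.1.neg,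
        (h3 hk).2.2.2.2⟩) hR (fun r hr => neg_nonneg.2 (hu r hr)) hv0
      (by simpa only [neg_add'] using hs'.neg)
    exact ⟨fun hβ r hr => (c1 hβ r hr).imp_left neg_eq_zero.1, fun hβ => (c2 hβ).symm.imp
      (fun hh r hr => neg_injective (hh r hr)) (fun hh r hr => by linarith [hh r hr])⟩

/-- Radial solutions with finitely many sign changes vanish if `β > -1`, and their components agree
up to sign if `β ≤ -1`. -/
theorem dichotomy (hk : k ≤ 2) (hq : -1 < q) (h : RadialSol k q β u v u1 v1)
    (h3 : k = 2 → q < 1 ∧ ContinuousOn u (Ici 0) ∧ ContinuousOn v (Ici 0) ∧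
      ContinuousOn u1 (Ici 0) ∧ ContinuousOn v1 (Ici 0))
    {C₁ C₂ C₃ C₄ : ℝ≥0} (hK : InClassK C₁ C₂ C₃ C₄ (Ioi 0) u v) :
    (-1 < β → ∀ r, 0 < r → u r = 0 ∧ v r = 0) ∧
      (β ≤ -1 → (∀ r, 0 < r → u r = v r) ∨ (∀ r, 0 < r → u r = -v r)) := by
  obtain ⟨R, hR, hu, hv, hs, hs'⟩ := hK.exists_constSign
  rcases hv with hv | hv
  · exact h.dichotomy_of_right_nonneg hk hq h3 hR hu hv hs hs'
  · obtain ⟨c1, c2⟩ := h.neg_right.dichotomy_of_right_nonneg hk hq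
      (fun hk => ⟨(h3 hk).1, (h3 hk).2.1, (h3 hk).2.2.1.neg, (h3 hk).2.2.2.1,
        (h3 hk).2.2.2.2.neg⟩) hR hu (fun r hr => neg_nonneg.2 (hv r hr))
      (by simpa only [sub_neg_eq_add] using hs') (by simpa only [← sub_eq_add_neg] using hs)
    exact ⟨fun hβ r hr => (c1 hβ r hr).imp_right neg_eq_zero.1, fun hβ => (c2 hβ).symm.imp
      (fun hh r hr => by simpa using hh r hr) (fun hh r hr => hh r hr)⟩

/-- If the components agree up to sign, `u` solves a scalar equation. -/
theorem hasDerivAt_deriv_of_eq_or_neg (h : RadialSol k q β u v u1 v1)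
    (huv : (∀ r, 0 < r → u r = v r) ∨ (∀ r, 0 < r → u r = -v r)) {r : ℝ} (hr : 0 < r) :
    HasDerivAt u1 (-(k / r) * u1 r + -(1 + β) * (|u r| ^ (2 * q + 2) * u r)) r := by
  refine (h.hu1 r hr).congr_deriv ?_
  rw [coupledNonlinearity_of_eq_or_neg q β (huv.imp (fun h => h r hr) fun h => h r hr)]
  ring

end RadialSol

/-! ### The scalar equation `Δw = c |w|^s w` -/

theorem monotoneOn_Ici_of_hasDerivAt {a : ℝ} {f f' : ℝ → ℝ} (hc : ContinuousOn f (Ici a))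
    (h : ∀ x, a < x → HasDerivAt f (f' x) x) (h0 : ∀ x, a < x → 0 ≤ f' x) :
    MonotoneOn f (Ici a) := by
  refine monotoneOn_of_deriv_nonneg (convex_Ici a) hc ?_ ?_ <;> rw [interior_Ici]
  · exact fun x hx => (h x hx).differentiableAt.differentiableWithinAt
  · intro x hx
    rw [(h x hx).deriv]
    exact h0 x hx

theorem eq_of_hasDerivAt_eq_zero_Ici {a : ℝ} {f f' : ℝ → ℝ} (hc : ContinuousOn f (Ici a))
    (h : ∀ x, a < x → HasDerivAt f (f' x) x) (h0 : ∀ x, a < x → f' x = 0) {x : ℝ} (hx : a ≤ x) :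
    f x = f a := by
  have h1 := monotoneOn_Ici_of_hasDerivAt hc h (fun x hx => (h0 x hx).ge) self_mem_Ici hx hx
  have h2 := monotoneOn_Ici_of_hasDerivAt (f := fun x => -f x) (f' := fun x => -f' x) hc.neg
    (fun x hx => (h x hx).neg) (fun x hx => (neg_eq_zero.2 (h0 x hx)).ge) self_mem_Ici hx hx
  simp only at h2
  linarith

section Scalar

variable {k : ℕ} {c s : ℝ} {w w1 : ℝ → ℝ}

/-- Writes the nonlinear term in `(w²)''` as a power of `w²`, so that `w²` satisfies the inequality
of `false_of_superlinear_growth`. -/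
theorem abs_rpow_mul_mul_self (hs : 0 < s) (x : ℝ) : |x| ^ s * x * x = (x ^ 2) ^ (s / 2 + 1) := by
  rw [← sq_abs x, ← Real.rpow_natCast |x|, ← Real.rpow_mul (abs_nonneg x)]
  have : ((2 : ℕ) : ℝ) * (s / 2 + 1) = s + (2 : ℕ) := by push_cast; ring
  rw [this, Real.rpow_add' (abs_nonneg x) (by positivity), Real.rpow_natCast, sq_abs]
  ring

theorem hasDerivAt_sq_scalar {x : ℝ} (hw : HasDerivAt w (w1 x) x) :
    HasDerivAt (fun x => w x ^ 2) (2 * (w x * w1 x)) x :=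
  (hw.pow 2).congr_deriv (by push_cast; ring)

/-- `w²` is nonincreasing along global solutions of `w'' = c |w|^s w`, `c, s > 0`. -/
theorem mul_deriv_nonpos_of_scalar {a : ℝ} (hc : 0 < c) (hs : 0 < s)
    (hw : ∀ x, a < x → HasDerivAt w (w1 x) x)
    (hw1 : ∀ x, a < x → HasDerivAt w1 (c * (|w x| ^ s * w x)) x) :
    ∀ x, a < x → w x * w1 x ≤ 0 := by
  intro y hy
  by_contra hpos
  push Not at hpos
  refine false_of_superlinear_growth (κ := 2 * c) (s := s / 2 + 1) (x0 := a) (by positivity)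
    (by linarith) (h := fun x => w x ^ 2) (h1 := fun x => 2 * (w x * w1 x))
    (h2 := fun x => 2 * (w1 x * w1 x + w x * (c * (|w x| ^ s * w x))))
    (fun x hx => hasDerivAt_sq_scalar (hw x hx)) (fun x hx => ((hw x hx).mul (hw1 x hx)).const_mul 2)
    (fun x _ => sq_nonneg _) (fun x hx => ?_) hy (by linarith)
  rw [← abs_rpow_mul_mul_self hs]
  nlinarith [mul_self_nonneg (w1 x)]

/-- Global radial solutions of `Δw = c |w|^s w`, `c, s > 0`, vanish. -/
theorem eq_zero_of_radial_scalar (hc : 0 < c) (hs : 0 < s)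
    (hw : ∀ x, 0 < x → HasDerivAt w (w1 x) x)
    (hw1 : ∀ x, 0 < x → HasDerivAt w1 (-(k / x) * w1 x + c * (|w x| ^ s * w x)) x)
    (cw : ContinuousOn w (Ici 0)) (cw1 : ContinuousOn w1 (Ici 0)) (h0 : w1 0 = 0) :
    ∀ x, 0 < x → w x = 0 := by
  have hpos : ∀ x, 0 ≤ |w x| ^ s * w x * w x := fun x => by
    rw [abs_rpow_mul_mul_self hs]; positivity
  have dθ : ∀ x, 0 < x → HasDerivAt (fun x => x ^ k * w1 x)
      (-(x ^ k * -(c * (|w x| ^ s * w x)))) x := fun x hx =>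
    hasDerivAt_pow_mul_radial hx.ne' ((hw1 x hx).congr_deriv (by ring))
  have cθ : ContinuousOn (fun x => x ^ k * w1 x) (Ici 0) := (continuousOn_pow k).mul cw1
  -- The function `w · x^k w'` is nondecreasing and starts at zero, because `w'(0) = 0`.
  have hχ : ∀ x, 0 < x → 0 ≤ w x * w1 x := by
    intro x hx
    have hm := monotoneOn_Ici_of_hasDerivAt (a := 0) (f := fun x => w x * (x ^ k * w1 x))
      (cw.mul cθ) (fun x hx => (hw x hx).mul (dθ x hx)) (fun x hx => by
        have e1 : 0 ≤ x ^ k * (w1 x * w1 x) := by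
          have := mul_self_nonneg (w1 x); positivity
        have e2 : 0 ≤ x ^ k * (c * (|w x| ^ s * w x * w x)) := by
          have := hpos x; positivity
        linarith)
      self_mem_Ici hx.le hx.le
    simp only [h0, mul_zero] at hm
    have : 0 < x ^ k := by positivity
    by_contra hneg
    push Not at hneg
    nlinarith
  have hmono : MonotoneOn (fun x => w x ^ 2) (Ici 0) :=
    monotoneOn_Ici_of_hasDerivAt (cw.pow 2) (fun x hx => hasDerivAt_sq_scalar (hw x hx))
      (fun x hx => by have := hχ x hx; linarith)
  -- Integrate `(x^k w')' = c x^k |w|^s w` from `0` to `r` after multiplying by the fixed value `w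
  -- r`, with `|w x| ≤ |w r|`. The damping then consumes at most the fraction `k/(k+1)` of the
  -- nonlinearity, which leaves `κ = 2c/(k+1)` for the blow-up argument.
  have hbound : ∀ r, 0 < r → w r * w1 r ≤ c * (|w r| ^ s * w r * w r) * r / (k + 1) := by
    intro r hr
    set W := |w r| ^ s * w r * w r with hW
    have hk : (0 : ℝ) < k + 1 := by positivity
    have hd : ∀ x, 0 < x → HasDerivAt (fun x => c * W * x ^ (k + 1) / (k + 1) -
        w r * (x ^ k * w1 x))
        (c * W * x ^ k - w r * (-(x ^ k * -(c * (|w x| ^ s * w x))))) x := fun x hx =>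
      ((((hasDerivAt_pow (k + 1) x).const_mul (c * W)).div_const _).congr_deriv (by
        push_cast; field_simp)).sub ((dθ x hx).const_mul _)
    have hm : MonotoneOn (fun x => c * W * x ^ (k + 1) / (k + 1) - w r * (x ^ k * w1 x))
        (Icc 0 r) := by
      refine monotoneOn_of_deriv_nonneg (convex_Icc 0 r) ?_ ?_ ?_
      · exact ((continuousOn_const.mul (continuousOn_pow _)).div_const _).sub
          (continuousOn_const.mul (cθ.mono Icc_subset_Ici_self))
      · rw [interior_Icc]
        exact fun x hx => (hd x hx.1).differentiableAt.differentiableWithinAt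
      · rw [interior_Icc]
        intro x hx
        rw [(hd x hx.1).deriv]
        have e1 : |w x| ≤ |w r| := sq_le_sq.1 (hmono hx.1.le hr.le hx.2.le)
        have e2 : w r * (|w x| ^ s * w x) ≤ W := by
          calc w r * (|w x| ^ s * w x) ≤ |w r * (|w x| ^ s * w x)| := le_abs_self _
            _ = |w r| * (|w x| ^ s * |w x|) := by
              rw [abs_mul, abs_mul, abs_of_nonneg (by positivity : 0 ≤ |w x| ^ s)]
            _ ≤ |w r| * (|w r| ^ s * |w r|) := by gcongr
            _ = W := by
              rw [hW, mul_assoc, ← abs_mul_abs_self (w r)]; ring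
        have e3 : 0 ≤ c * x ^ k := by have := hx.1.le; positivity
        nlinarith [mul_le_mul_of_nonneg_left e2 e3]
    have := hm (left_mem_Icc.2 hr.le) (right_mem_Icc.2 hr.le) hr.le
    simp only [h0, mul_zero, sub_zero] at this
    have e0 : c * W * 0 ^ (k + 1) / ((k : ℝ) + 1) = 0 := by simp
    rw [e0, sub_nonneg, pow_succ] at this
    have hrk : 0 < r ^ k := by positivity
    refine le_of_mul_le_mul_left ?_ hrk
    calc r ^ k * (w r * w1 r) = w r * (r ^ k * w1 r) := by ring
      _ ≤ _ := this
      _ = _ := by ring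
  have hχ0 : ∀ x, 0 < x → w x * w1 x = 0 := by
    intro y hy
    by_contra hne
    have hpos' : 0 < w y * w1 y := lt_of_le_of_ne (hχ y hy) (Ne.symm hne)
    refine false_of_superlinear_growth (κ := 2 * c / (k + 1)) (s := s / 2 + 1) (x0 := 0)
      (by positivity) (by linarith) (h := fun x => w x ^ 2) (h1 := fun x => 2 * (w x * w1 x))
      (h2 := fun x => 2 * (w1 x * w1 x + w x * (-(k / x) * w1 x + c * (|w x| ^ s * w x))))
      (fun x hx => hasDerivAt_sq_scalar (hw x hx))
      (fun x hx => ((hw x hx).mul (hw1 x hx)).const_mul 2)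
      (fun x _ => sq_nonneg _) (fun x hx => ?_) hy (by linarith)
    rw [← abs_rpow_mul_mul_self hs]
    have e1 := mul_le_mul_of_nonneg_left (hbound x hx) (by positivity : (0 : ℝ) ≤ k / x)
    set W := |w x| ^ s * w x * w x with hW
    have e2 : (k : ℝ) / x * (c * W * x / (k + 1)) = c * W - c * W / (k + 1) := by
      field_simp; ring
    have e3 : 2 * c / (k + 1) * W = 2 * (c * W / (k + 1)) := by ring
    have e4 : w x * (-(k / x) * w1 x + c * (|w x| ^ s * w x)) =
      c * W - k / x * (w x * w1 x) := by rw [hW]; ring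
    rw [e3, e4]
    rw [e2] at e1
    nlinarith [mul_self_nonneg (w1 x)]
  intro x hx
  -- Differentiating `w w' = 0` makes a sum of nonnegative terms containing `c |w|^s w²` vanish.
  have d0 : HasDerivAt (fun x => w x * w1 x) 0 x := by
    refine (hasDerivAt_const x (0 : ℝ)).congr_of_eventuallyEq ?_
    filter_upwards [Ioi_mem_nhds hx] with y hy
    exact hχ0 y hy
  have e := d0.unique ((hw x hx).mul (hw1 x hx))
  have e1 : c * (|w x| ^ s * w x * w x) ≤ 0 := by
    have : (k : ℝ) / x * (w x * w1 x) = 0 := by rw [hχ0 x hx, mul_zero]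
    nlinarith [mul_self_nonneg (w1 x)]
  rw [abs_rpow_mul_mul_self hs] at e1
  by_contra hne
  have : 0 < c * (w x ^ 2) ^ (s / 2 + 1) := by
    have : 0 < w x ^ 2 := by positivity
    positivity
  linarith

/-- Solutions of `w'' = c |w|^s w`, `c, s > 0`, on the half-line with `w(0) = 0` vanish. -/
theorem eq_zero_of_halfLine_scalar (hc : 0 < c) (hs : 0 < s)
    (hw : ∀ x, 0 < x → HasDerivAt w (w1 x) x)
    (hw1 : ∀ x, 0 < x → HasDerivAt w1 (c * (|w x| ^ s * w x)) x)
    (cw : ContinuousOn w (Ici 0)) (h0 : w 0 = 0) {x : ℝ} (hx : 0 ≤ x) : w x = 0 := by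
  have h1 := mul_deriv_nonpos_of_scalar hc hs hw hw1
  have h2 := monotoneOn_Ici_of_hasDerivAt (f := fun x => -w x ^ 2) (cw.pow 2).neg
    (fun x hx => (hasDerivAt_sq_scalar (hw x hx)).neg)
    (fun x hx => by have := h1 x hx; linarith) self_mem_Ici hx hx
  simp only [h0] at h2
  nlinarith [sq_nonneg (w x)]

/-- Global solutions of `w'' = c |w|^s w`, `c, s > 0`, on the line vanish. -/
theorem eq_zero_of_line_scalar (hc : 0 < c) (hs : 0 < s)
    (hw : ∀ x, HasDerivAt w (w1 x) x)
    (hw1 : ∀ x, HasDerivAt w1 (c * (|w x| ^ s * w x)) x) (x : ℝ) : w x = 0 := by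
  have hle : ∀ x, w x * w1 x ≤ 0 := fun x =>
    mul_deriv_nonpos_of_scalar (a := x - 1) hc hs (fun x _ => hw x) (fun x _ => hw1 x) x
      (by linarith)
  -- The same inequality for the reflected function `w (-x)`.
  have hge : ∀ x, 0 ≤ w x * w1 x := fun x => by
    have := mul_deriv_nonpos_of_scalar (a := -x - 1) (w := fun x => w (-x))
      (w1 := fun x => -w1 (-x)) hc hs
      (fun x _ => ((hw (-x)).comp x (hasDerivAt_neg x)).congr_deriv (by ring))
      (fun x _ => ((hw1 (-x)).comp x (hasDerivAt_neg x)).neg.congr_deriv (by ring)) (-x)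
      (by linarith)
    simp only [neg_neg] at this
    linarith
  have h0 : (fun x => w x * w1 x) = fun _ => 0 := funext fun x => le_antisymm (hle x) (hge x)
  have d0 := (hw x).mul (hw1 x)
  have d1 : HasDerivAt (fun x => w x * w1 x) 0 x := h0 ▸ hasDerivAt_const x (0 : ℝ)
  have e := d1.unique d0
  have e1 : c * (|w x| ^ s * w x * w x) ≤ 0 := by nlinarith [mul_self_nonneg (w1 x)]
  rw [abs_rpow_mul_mul_self hs] at e1
  by_contra hne
  have : 0 < c * (w x ^ 2) ^ (s / 2 + 1) := by
    have : 0 < w x ^ 2 := by positivity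
    positivity
  linarith

end Scalar

/-! ### The Laplacian of a radial function -/

section RadialLaplacian

variable {E : Type*} [NormedAddCommGroup E] [InnerProductSpace ℝ E] {u : E → ℝ}

theorem hasDerivAt_along_line (hu : ContDiff ℝ 2 u) (x e : E) (t : ℝ) :
    HasDerivAt (fun s : ℝ => u (x + s • e)) (fderiv ℝ u (x + t • e) e) t := by
  have hd : HasFDerivAt u (fderiv ℝ u (x + t • e)) (x + t • e) :=
    (hu.differentiable (by norm_num) _).hasFDerivAt
  exact hd.comp_hasDerivAt t
    ((((hasDerivAt_id t).smul_const e).const_add x).congr_deriv (one_smul ℝ e))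

theorem hasDerivAt_fderiv_along_line (hu : ContDiff ℝ 2 u) (x e : E) (t : ℝ) :
    HasDerivAt (fun s : ℝ => fderiv ℝ u (x + s • e) e)
      (fderiv ℝ (fderiv ℝ u) (x + t • e) e e) t := by
  have h1 : ContDiff ℝ 1 (fderiv ℝ u) := hu.fderiv_right (by norm_num)
  have hd : HasFDerivAt (fderiv ℝ u) (fderiv ℝ (fderiv ℝ u) (x + t • e)) (x + t • e) :=
    (h1.differentiable (by norm_num) _).hasFDerivAt
  have := hd.comp_hasDerivAt t
    ((((hasDerivAt_id t).smul_const e).const_add x).congr_deriv (one_smul ℝ e))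
  exact this.clm_apply (hasDerivAt_const t e) |>.congr_deriv (by simp)

theorem norm_smul_add_smul_of_orthonormal {e b : E} (he : ‖e‖ = 1) (hb : ‖b‖ = 1)
    (heb : inner ℝ e b = 0) (t s : ℝ) : ‖t • e + s • b‖ = √(t ^ 2 + s ^ 2) := by
  rw [← Real.sqrt_sq (norm_nonneg _), norm_add_sq_real, inner_smul_left, inner_smul_right, heb,
    norm_smul, norm_smul, he, hb]
  simp

/-- Second derivative of a radial function in a direction tangential to the sphere. -/
theorem fderiv_fderiv_tangential (hu : ContDiff ℝ 2 u) {f : ℝ → ℝ} (hf : ∀ x, u x = f ‖x‖)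
    {e b : E} (he : ‖e‖ = 1) (hb : ‖b‖ = 1) (heb : inner ℝ e b = 0) {t : ℝ} (ht : 0 < t) :
    fderiv ℝ (fderiv ℝ u) (t • e) b b = fderiv ℝ u (t • e) e / t := by
  have hρ : ∀ s : ℝ, 0 < t ^ 2 + s ^ 2 := fun s => by positivity
  have hval : ∀ s : ℝ, u (t • e + s • b) = u (0 + √(t ^ 2 + s ^ 2) • e) := fun s => by
    rw [hf, hf, norm_smul_add_smul_of_orthonormal he hb heb, zero_add, norm_smul, he, mul_one,
      Real.norm_of_nonneg (Real.sqrt_nonneg _)]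
  have hd1 : ∀ s : ℝ, fderiv ℝ u (t • e + s • b) b =
      s * (fderiv ℝ u (√(t ^ 2 + s ^ 2) • e) e / √(t ^ 2 + s ^ 2)) := by
    intro s
    have h1 := hasDerivAt_along_line hu (t • e) b s
    have hsq : HasDerivAt (fun s : ℝ => √(t ^ 2 + s ^ 2)) (s / √(t ^ 2 + s ^ 2)) s := by
      have := ((hasDerivAt_pow 2 s).const_add (t ^ 2)).sqrt (hρ s).ne'
      refine this.congr_deriv ?_
      push_cast
      field_simp
    have h2 := (hasDerivAt_along_line hu 0 e (√(t ^ 2 + s ^ 2))).comp s hsq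
    have h3 : (fun s : ℝ => u (t • e + s • b)) =
      (fun s : ℝ => u (0 + s • e)) ∘ fun s : ℝ => √(t ^ 2 + s ^ 2) := funext hval
    rw [h3] at h1
    rw [h1.unique h2, zero_add]
    ring
  have h1 := hasDerivAt_fderiv_along_line hu (t • e) b 0
  have hcont : Continuous (fun s : ℝ => fderiv ℝ u (√(t ^ 2 + s ^ 2) • e) e / √(t ^ 2 + s ^ 2)) := by
    have hc : Continuous (fderiv ℝ u) := hu.continuous_fderiv (by norm_num)
    have hs : Continuous fun s : ℝ => √(t ^ 2 + s ^ 2) := by fun_prop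
    exact ((hc.comp (hs.smul continuous_const)).clm_apply continuous_const).div hs
      fun s => (Real.sqrt_pos.2 (hρ s)).ne'
  -- The tangential derivative is `s` times a continuous function of `s`, so its slope at `0` is the
  -- value of that function there.
  have h2 : HasDerivAt (fun s : ℝ => fderiv ℝ u (t • e + s • b) b)
      (fderiv ℝ u (√(t ^ 2 + 0 ^ 2) • e) e / √(t ^ 2 + 0 ^ 2)) 0 := by
    rw [hasDerivAt_iff_tendsto_slope]
    refine (hcont.tendsto 0 |>.mono_left nhdsWithin_le_nhds).congr' ?_
    filter_upwards [self_mem_nhdsWithin] with s hs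
    have hs : s ≠ 0 := hs
    rw [slope_def_field, hd1, hd1]
    field_simp
    ring
  have h3 := h1.unique h2
  simpa [Real.sqrt_sq ht.le] using h3

/-- In the standard basis at a point of the first axis, one direction is radial and the other `k`
are tangential. -/
theorem laplacian_radial {k : ℕ} {u : EuclideanSpace ℝ (Fin (k + 1)) → ℝ} (hu : ContDiff ℝ 2 u)
    {f : ℝ → ℝ} (hf : ∀ x, u x = f ‖x‖) {t : ℝ} (ht : 0 < t) :
    (Laplacian.laplacian u : EuclideanSpace ℝ (Fin (k + 1)) → ℝ)
        (t • EuclideanSpace.basisFun (Fin (k + 1)) ℝ 0) =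
      fderiv ℝ (fderiv ℝ u) (t • EuclideanSpace.basisFun (Fin (k + 1)) ℝ 0)
        (EuclideanSpace.basisFun (Fin (k + 1)) ℝ 0) (EuclideanSpace.basisFun (Fin (k + 1)) ℝ 0) +
      k / t * fderiv ℝ u (t • EuclideanSpace.basisFun (Fin (k + 1)) ℝ 0)
        (EuclideanSpace.basisFun (Fin (k + 1)) ℝ 0) := by
  set b := EuclideanSpace.basisFun (Fin (k + 1)) ℝ
  rw [InnerProductSpace.laplacian_eq_iteratedFDeriv_orthonormalBasis u b]
  simp only [Fin.sum_univ_succ, iteratedFDeriv_two_apply, Matrix.cons_val_zero, Matrix.cons_val_one]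
  have : ∀ i : Fin k, fderiv ℝ (fderiv ℝ u) (t • b 0) (b i.succ) (b i.succ) =
      fderiv ℝ u (t • b 0) (b 0) / t := fun i =>
    fderiv_fderiv_tangential hu hf (b.norm_eq_one _) (b.norm_eq_one _)
      (b.orthonormal.2 (Fin.succ_ne_zero i).symm) ht
  rw [Finset.sum_congr rfl fun i _ => this i, Finset.sum_const, Finset.card_univ, Fintype.card_fin,
    nsmul_eq_mul]
  ring

/-- Derivatives of the profile of a radial `C²` function. -/
theorem exists_deriv_profile {k : ℕ} {u : EuclideanSpace ℝ (Fin (k + 1)) → ℝ}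
    (hu : ContDiff ℝ 2 u) {f : ℝ → ℝ} (hf : ∀ x, u x = f ‖x‖) :
    ∃ f1 : ℝ → ℝ, Continuous f1 ∧ f1 0 = 0 ∧ (∀ r, 0 < r → HasDerivAt f (f1 r) r) ∧
      ∀ r, 0 < r → HasDerivAt f1 (-(k / r) * f1 r +
        (Laplacian.laplacian u : EuclideanSpace ℝ (Fin (k + 1)) → ℝ)
          (r • EuclideanSpace.basisFun (Fin (k + 1)) ℝ 0)) r := by
  set e := EuclideanSpace.basisFun (Fin (k + 1)) ℝ 0 with he
  have hne : ‖e‖ = 1 := (EuclideanSpace.basisFun (Fin (k + 1)) ℝ).norm_eq_one 0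
  have hline : ∀ t : ℝ, HasDerivAt (fun s : ℝ => u (s • e)) (fderiv ℝ u (t • e) e) t := fun t => by
    simpa using hasDerivAt_along_line hu 0 e t
  refine ⟨fun t => fderiv ℝ u (t • e) e, ?_, ?_, fun r hr => ?_, fun r hr => ?_⟩
  · exact ((hu.continuous_fderiv (by norm_num)).comp
      (continuous_id.smul continuous_const)).clm_apply continuous_const
  · have h1 := hline 0
    -- Radial symmetry makes `u` even along the axis, so its derivative at the origin equals its own
    -- negative.
    have h2 : HasDerivAt (fun s : ℝ => u (s • e)) (fderiv ℝ u ((0 : ℝ) • e) e * -1) 0 := by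
      have h3 : HasDerivAt (fun s : ℝ => u (s • e)) (fderiv ℝ u ((0 : ℝ) • e) e) (-0) := by
        simpa using h1
      refine (h3.comp 0 (hasDerivAt_neg 0)).congr_of_eventuallyEq
        (Filter.Eventually.of_forall fun s => ?_)
      simp only [Function.comp, hf, norm_smul, norm_neg]
    have := h1.unique h2
    linarith
  · refine (hline r).congr_of_eventuallyEq ?_
    filter_upwards [Ioi_mem_nhds hr] with s hs
    have hs : 0 < s := hs
    rw [hf, norm_smul, hne, mul_one, Real.norm_of_nonneg hs.le]
  · have h1 := hasDerivAt_fderiv_along_line hu 0 e r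
    simp only [zero_add] at h1
    refine h1.congr_deriv ?_
    rw [laplacian_radial hu hf hr]
    ring

end RadialLaplacian

theorem IsEntireSolution.exists_radialSol {k : ℕ} {q β : ℝ}
    {u v : EuclideanSpace ℝ (Fin (k + 1)) → ℝ} {f g : ℝ → ℝ} (h : IsEntireSolution q β u v)
    (hf : ∀ x, u x = f ‖x‖) (hg : ∀ x, v x = g ‖x‖) :
    ∃ f1 g1 : ℝ → ℝ, RadialSol k q β f g f1 g1 ∧ Continuous f1 ∧ Continuous g1 ∧ f1 0 = 0 ∧
      g1 0 = 0 := by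
  obtain ⟨f1, cf, f0, df, df1⟩ := exists_deriv_profile h.contDiff_left hf
  obtain ⟨g1, cg, g0, dg, dg1⟩ := exists_deriv_profile h.contDiff_right hg
  have hn : ∀ r : ℝ, 0 < r → ‖r • EuclideanSpace.basisFun (Fin (k + 1)) ℝ 0‖ = r := fun r hr => by
    rw [norm_smul, (EuclideanSpace.basisFun (Fin (k + 1)) ℝ).norm_eq_one 0, mul_one,
      Real.norm_of_nonneg hr.le]
  refine ⟨f1, g1, ⟨df, dg, fun r hr => (df1 r hr).congr_deriv ?_,
    fun r hr => (dg1 r hr).congr_deriv ?_⟩, cf, cg, f0, g0⟩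
  · have := h.eq_left (r • EuclideanSpace.basisFun (Fin (k + 1)) ℝ 0)
    rw [hf, hg, hn r hr] at this
    linarith
  · have := h.eq_right (r • EuclideanSpace.basisFun (Fin (k + 1)) ℝ 0)
    rw [hf, hg, hn r hr] at this
    linarith

/-! ### Consequences for radial and half-line solutions -/

namespace RadialSol

variable {k : ℕ} {q β : ℝ} {u v u1 v1 : ℝ → ℝ} {C₁ C₂ C₃ C₄ : ℝ≥0}

theorem eq_zero_of_ne (hk : k ≤ 2) (hq : -1 < q) (hq1 : k = 2 → q < 1)
    (h : RadialSol k q β u v u1 v1) (cu : ContinuousOn u (Ici 0)) (cv : ContinuousOn v (Ici 0))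
    (cu1 : Continuous u1) (cv1 : Continuous v1) (hu1 : u1 0 = 0)
    (hK : InClassK C₁ C₂ C₃ C₄ (Ioi 0) u v) (hβ : β ≠ -1) : ∀ r, 0 < r → u r = 0 ∧ v r = 0 := by
  obtain ⟨d1, d2⟩ := h.dichotomy hk hq
    (fun hk => ⟨hq1 hk, cu, cv, cu1.continuousOn, cv1.continuousOn⟩) hK
  rcases lt_or_gt_of_ne hβ with hlt | hgt
  · have huv := d2 hlt.le
    have hu := eq_zero_of_radial_scalar (c := -(1 + β)) (by linarith)
      (by linarith : 0 < 2 * q + 2) h.hu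
      (fun r hr => h.hasDerivAt_deriv_of_eq_or_neg huv hr) cu cu1.continuousOn hu1
    intro r hr
    refine ⟨hu r hr, ?_⟩
    rcases huv with huv | huv
    · rw [← huv r hr, hu r hr]
    · rw [← neg_eq_zero, ← huv r hr, hu r hr]
  · exact d1 hgt

theorem const_of_eq (hk : k ≤ 2) (hq : -1 < q) (hq1 : k = 2 → q < 1)
    (h : RadialSol k q (-1) u v u1 v1) (cu : ContinuousOn u (Ici 0)) (cv : ContinuousOn v (Ici 0))
    (cu1 : Continuous u1) (cv1 : Continuous v1) (hu1 : u1 0 = 0)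
    (hK : InClassK C₁ C₂ C₃ C₄ (Ioi 0) u v) :
    (∀ r, 0 ≤ r → u r = u 0) ∧ ((∀ r, 0 < r → u r = v r) ∨ (∀ r, 0 < r → u r = -v r)) := by
  have huv := (h.dichotomy hk hq
    (fun hk => ⟨hq1 hk, cu, cv, cu1.continuousOn, cv1.continuousOn⟩) hK).2 le_rfl
  refine ⟨fun r hr => ?_, huv⟩
  have hθ : ∀ r, 0 ≤ r → r ^ k * u1 r = 0 ^ k * u1 0 := fun r hr =>
    eq_of_hasDerivAt_eq_zero_Ici (f := fun r => r ^ k * u1 r) ((continuousOn_pow k).mul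
      cu1.continuousOn)
      (fun r hr => hasDerivAt_pow_mul_radial hr.ne'
        -- At `β = -1` the right-hand side vanishes; the explicit `- 0` puts the equation in
        -- divergence form with `g = 0`.
        ((h.hasDerivAt_deriv_of_eq_or_neg huv hr).congr_deriv (g' := _ - 0) (by simp)))
      (fun r _ => by simp) hr
  refine eq_of_hasDerivAt_eq_zero_Ici cu h.hu (fun r hr => ?_) hr
  have := hθ r hr.le
  rw [hu1, mul_zero] at this
  exact (mul_eq_zero.1 this).resolve_left (by positivity)

theorem halfLine_eq_zero (hq : -1 < q) (h : RadialSol 0 q β u v u1 v1)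
    (cu : ContinuousOn u (Ici 0)) (hu0 : u 0 = 0)
    (hK : InClassK C₁ C₂ C₃ C₄ (Ioi 0) u v) (hβ : β ≠ -1) : ∀ r, 0 < r → u r = 0 ∧ v r = 0 := by
  obtain ⟨d1, d2⟩ := h.dichotomy (by norm_num) hq (fun h => by simp at h) hK
  rcases lt_or_gt_of_ne hβ with hlt | hgt
  · have huv := d2 hlt.le
    have hu : ∀ r, 0 < r → u r = 0 := fun r hr =>
      eq_zero_of_halfLine_scalar (c := -(1 + β)) (by linarith) (by linarith : 0 < 2 * q + 2) h.hu
        (fun r hr => (h.hasDerivAt_deriv_of_eq_or_neg huv hr).congr_deriv (by simp)) cu hu0 hr.le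
    intro r hr
    refine ⟨hu r hr, ?_⟩
    rcases huv with huv | huv
    · rw [← huv r hr, hu r hr]
    · rw [← neg_eq_zero, ← huv r hr, hu r hr]
  · exact d1 hgt

theorem halfLine_linear (hq : -1 < q) (h : RadialSol 0 q (-1) u v u1 v1)
    (cu : ContinuousOn u (Ici 0)) (hu0 : u 0 = 0)
    (hK : InClassK C₁ C₂ C₃ C₄ (Ioi 0) u v) :
    ∃ a : ℝ, (∀ r, 0 < r → u r = a * r) ∧
      ((∀ r, 0 < r → v r = a * r) ∨ (∀ r, 0 < r → v r = -(a * r))) := by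
  have huv := (h.dichotomy (by norm_num) hq (fun h => by simp at h) hK).2 le_rfl
  have d0 : ∀ r, 0 < r → HasDerivAt u1 0 r := fun r hr =>
    (h.hasDerivAt_deriv_of_eq_or_neg huv hr).congr_deriv (by simp)
  have hconst : ∀ r, 0 < r → u1 r = u1 1 := by
    have m1 := monotoneOn_Ioi_of_hasDerivAt d0 (fun _ _ => le_rfl)
    have m2 := antitoneOn_Ioi_of_hasDerivAt d0 (fun _ _ => le_rfl)
    intro r hr
    rcases le_total r 1 with h1 | h1
    · exact le_antisymm (m1 hr (mem_Ioi.2 one_pos) h1) (m2 hr (mem_Ioi.2 one_pos) h1)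
    · exact le_antisymm (m2 (mem_Ioi.2 one_pos) hr h1) (m1 (mem_Ioi.2 one_pos) hr h1)
  have hu : ∀ r, 0 < r → u r = u1 1 * r := by
    intro r hr
    have := eq_of_hasDerivAt_eq_zero_Ici (a := 0) (f := fun r => u r - u1 1 * r)
      (f' := fun r => u1 r - u1 1 * 1) (cu.sub (continuousOn_const.mul continuousOn_id))
      (fun r hr => (h.hu r hr).sub ((hasDerivAt_id r).const_mul _))
      (fun r hr => by rw [hconst r hr]; ring) hr.le
    simp only [hu0, mul_zero, sub_zero] at this
    linarith
  refine ⟨u1 1, hu, huv.imp (fun huv r hr => ?_) fun huv r hr => ?_⟩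
  · rw [← huv r hr, hu r hr]
  · rw [← hu r hr, huv r hr, neg_neg]

end RadialSol

theorem IsHalfLineSolution.radialSol {q β : ℝ} {u v : ℝ → ℝ} (h : IsHalfLineSolution q β u v) :
    RadialSol 0 q β u v (deriv u) (deriv v) := by
  have d1 : ∀ {w : ℝ → ℝ}, ContDiffOn ℝ 2 w (Ioi 0) → ∀ r, 0 < r → HasDerivAt w (deriv w r) r :=
    fun hw r hr => ((hw.differentiableOn (by norm_num)).differentiableAt
      (Ioi_mem_nhds hr)).hasDerivAt
  have d2 : ∀ {w : ℝ → ℝ}, ContDiffOn ℝ 2 w (Ioi 0) → ∀ r, 0 < r →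
      HasDerivAt (deriv w) (deriv (deriv w) r) r := fun hw r hr =>
    (((hw.deriv_of_isOpen (m := 1) isOpen_Ioi (by norm_num)).differentiableOn
      (by norm_num)).differentiableAt (Ioi_mem_nhds hr)).hasDerivAt
  refine ⟨d1 h.contDiffOn_left, d1 h.contDiffOn_right,
    fun r hr => (d2 h.contDiffOn_left r hr).congr_deriv ?_,
    fun r hr => (d2 h.contDiffOn_right r hr).congr_deriv ?_⟩
  · rw [← h.eq_left r hr]; simp
  · rw [← h.eq_right r hr]; simp

/-! ### Solutions on the line -/

section Line

variable {q β : ℝ} {u v : ℝ → ℝ} {C₁ C₂ C₃ C₄ : ℝ≥0}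

theorem IsEntireSolution.hasDerivAt_line (h : IsEntireSolution q β u v) :
    (∀ x, HasDerivAt u (deriv u x) x) ∧ (∀ x, HasDerivAt v (deriv v x) x) ∧
      (∀ x, HasDerivAt (deriv u) (-coupledNonlinearity q β (u x) (v x)) x) ∧
      ∀ x, HasDerivAt (deriv v) (-coupledNonlinearity q β (v x) (u x)) x := by
  have d1 : ∀ {w : ℝ → ℝ}, ContDiff ℝ 2 w → ∀ x, HasDerivAt w (deriv w x) x := fun hw x =>
    (hw.differentiable (by norm_num) x).hasDerivAt
  have d2 : ∀ {w : ℝ → ℝ}, ContDiff ℝ 2 w → ∀ x,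
      HasDerivAt (deriv w) ((Laplacian.laplacian w : ℝ → ℝ) x) x := fun {w} hw x => by
    rw [InnerProductSpace.laplacian_eq_iteratedDeriv_real, iteratedDeriv_succ, iteratedDeriv_one]
    exact ((contDiff_succ_iff_deriv (n := 1)).1 hw).2.2.differentiable (by norm_num) x
      |>.hasDerivAt
  exact ⟨d1 h.contDiff_left, d1 h.contDiff_right,
    fun x => (d2 h.contDiff_left x).congr_deriv (by rw [← h.eq_left x, neg_neg]),
    fun x => (d2 h.contDiff_right x).congr_deriv (by rw [← h.eq_right x, neg_neg])⟩

theorem IsEntireSolution.radialSol_line (h : IsEntireSolution q β u v) (a : ℝ) :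
    RadialSol 0 q β (fun r => u (r + a)) (fun r => v (r + a)) (fun r => deriv u (r + a))
      (fun r => deriv v (r + a)) := by
  obtain ⟨h1, h2, h3, h4⟩ := h.hasDerivAt_line
  exact ⟨fun r _ => (h1 (r + a)).comp_add_const r a, fun r _ => (h2 (r + a)).comp_add_const r a,
    fun r _ => ((h3 (r + a)).comp_add_const r a).congr_deriv (by simp),
    fun r _ => ((h4 (r + a)).comp_add_const r a).congr_deriv (by simp)⟩

theorem IsEntireSolution.dichotomy_line (hq : -1 < q) (h : IsEntireSolution q β u v)
    (hK : InClassK C₁ C₂ C₃ C₄ univ u v) :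
    (-1 < β → ∀ x, u x = 0 ∧ v x = 0) ∧
      (β ≤ -1 → (∀ x, u x = v x) ∨ (∀ x, u x = -v x)) := by
  have key : ∀ a, _ := fun a => (h.radialSol_line a).dichotomy (by norm_num) hq
    (fun h => by simp at h)
    (hK.of_strictMono (J := Ioi 0) (g := fun x => x + a) (fun x y hxy => by simpa using hxy)
      (fun _ _ => mem_univ _) (fun _ _ => rfl) (fun _ _ => rfl))
  -- The sign in `u = ±v` could depend on the half-line `(a, ∞)`; if both signs failed somewhere, a
  -- half-line containing both points would contradict `key`.
  refine ⟨fun hβ x => by simpa using (key (x - 1)).1 hβ 1 one_pos, fun hβ => ?_⟩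
  by_contra hcon
  push Not at hcon
  obtain ⟨⟨x, hx⟩, ⟨y, hy⟩⟩ := hcon
  rcases (key (min x y - 1)).2 hβ with hk | hk
  · have := hk (x - (min x y - 1)) (by have := min_le_left x y; linarith)
    exact hx (by simpa using this)
  · have := hk (y - (min x y - 1)) (by have := min_le_right x y; linarith)
    exact hy (by simpa using this)

theorem IsEntireSolution.hasDerivAt_deriv_line (h : IsEntireSolution q β u v)
    (huv : (∀ x, u x = v x) ∨ (∀ x, u x = -v x)) (x : ℝ) :
    HasDerivAt (deriv u) (-(1 + β) * (|u x| ^ (2 * q + 2) * u x)) x := by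
  refine (h.hasDerivAt_line.2.2.1 x).congr_deriv ?_
  rw [coupledNonlinearity_of_eq_or_neg q β (huv.imp (fun h => h x) fun h => h x), neg_mul]

theorem IsEntireSolution.line_eq_zero (hq : -1 < q) (h : IsEntireSolution q β u v)
    (hK : InClassK C₁ C₂ C₃ C₄ univ u v) (hβ : β ≠ -1) (x : ℝ) : u x = 0 ∧ v x = 0 := by
  obtain ⟨d1, d2⟩ := h.dichotomy_line hq hK
  rcases lt_or_gt_of_ne hβ with hlt | hgt
  · have huv := d2 hlt.le
    have hu := eq_zero_of_line_scalar (c := -(1 + β)) (by linarith) (by linarith : 0 < 2 * q + 2)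
      h.hasDerivAt_line.1 (h.hasDerivAt_deriv_line huv)
    refine ⟨hu x, ?_⟩
    rcases huv with huv | huv
    · rw [← huv, hu]
    · rw [← neg_eq_zero, ← huv, hu]
  · exact d1 hgt x

theorem IsEntireSolution.line_affine (hq : -1 < q) (h : IsEntireSolution q (-1) u v)
    (hK : InClassK C₁ C₂ C₃ C₄ univ u v) :
    ∃ a b : ℝ, (∀ x, u x = a * x + b) ∧
      ((∀ x, v x = a * x + b) ∨ (∀ x, v x = -(a * x + b))) := by
  have huv := (h.dichotomy_line hq hK).2 le_rfl
  have h1 := h.hasDerivAt_line.1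
  have h2 : ∀ x, HasDerivAt (deriv u) 0 x := fun x =>
    (h.hasDerivAt_deriv_line huv x).congr_deriv (by simp)
  have hconst : ∀ x, deriv u x = deriv u 0 := fun x =>
    is_const_of_deriv_eq_zero (fun x => (h2 x).differentiableAt) (fun x => (h2 x).deriv) x 0
  have h3 : ∀ x, HasDerivAt (fun x => u x - deriv u 0 * x) 0 x := fun x =>
    ((h1 x).sub ((hasDerivAt_id x).const_mul (deriv u 0))).congr_deriv (by rw [hconst x]; ring)
  have hu : ∀ x, u x = deriv u 0 * x + u 0 := fun x => by
    have := is_const_of_deriv_eq_zero (fun x => (h3 x).differentiableAt)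
      (fun x => (h3 x).deriv) x 0
    simp only [mul_zero, sub_zero] at this
    linarith
  refine ⟨deriv u 0, u 0, hu, huv.imp (fun huv x => ?_) fun huv x => ?_⟩
  · rw [← huv, hu]
  · rw [← hu, huv, neg_neg]

end Line

/-! ### Assembly -/

theorem eq_zero_of_abs_mul_add_le {a b M : ℝ} (h : ∀ x, 0 < x → |a * x + b| ≤ M) : a = 0 := by
  by_contra ha
  have ha' : 0 < |a| := abs_pos.2 ha
  have hM : 0 ≤ M := (abs_nonneg _).trans (h 1 one_pos)
  have hx : 0 < (M + |b| + 1) / |a| := by positivity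
  have h1 := h _ hx
  have h2 : |a * ((M + |b| + 1) / |a|)| = M + |b| + 1 := by
    rw [abs_mul, abs_of_pos hx]; field_simp
  have h3 := abs_sub_abs_le_abs_sub (a * ((M + |b| + 1) / |a|)) (-b)
  rw [sub_neg_eq_add, abs_neg, h2] at h3
  linarith

theorem mainTheorem1 (n : ℕ) (hn1 : 1 ≤ n) (hn3 : n ≤ 3) (p q β : ℝ) (hpq : p = 2 * q + 3)
    (hp1 : 1 < p) (hpS : (p : EReal) < sobolevCriticalExponent n) (C₁ C₂ C₃ C₄ : ℝ≥0) :
    -- `β ≠ -1`: no nontrivial radial solutions in `ℝⁿ`, no nontrivial solutions in `ℝ`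
    (β ≠ -1 →
      (¬ ∃ (u v : EuclideanSpace ℝ (Fin n) → ℝ) (f g : ℝ → ℝ),
        IsEntireSolution q β u v ∧ HasRadialProfile u f ∧ HasRadialProfile v g ∧
        InClassK C₁ C₂ C₃ C₄ (Ici 0) f g ∧ ∃ x, (u x, v x) ≠ (0, 0)) ∧
      (¬ ∃ u v : ℝ → ℝ,
        IsEntireSolution q β u v ∧ InClassK C₁ C₂ C₃ C₄ univ u v ∧ ∃ x, (u x, v x) ≠ (0, 0))) ∧
    -- `β = -1`: radial solutions are `(c, ±c)`; solutions in `ℝ` are `(ℓ, ±ℓ)` with `ℓ` affine,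
    -- and `(c, ±c)` if they are bounded
    (β = -1 →
      (∀ (u v : EuclideanSpace ℝ (Fin n) → ℝ) (f g : ℝ → ℝ),
        IsEntireSolution q β u v → HasRadialProfile u f → HasRadialProfile v g →
        InClassK C₁ C₂ C₃ C₄ (Ici 0) f g →
        ∃ c : ℝ, (∀ x, u x = c) ∧ ((∀ x, v x = c) ∨ (∀ x, v x = -c))) ∧
      (∀ u v : ℝ → ℝ,
        IsEntireSolution q β u v → InClassK C₁ C₂ C₃ C₄ univ u v →
        (∃ a b : ℝ, (∀ x, u x = a * x + b) ∧
          ((∀ x, v x = a * x + b) ∨ (∀ x, v x = -(a * x + b)))) ∧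
        ((∃ M : ℝ, ∀ x, |u x| ≤ M ∧ |v x| ≤ M) →
          ∃ c : ℝ, (∀ x, u x = c) ∧ ((∀ x, v x = c) ∨ (∀ x, v x = -c))))) ∧
    -- the half-line Dirichlet problem: no nontrivial solutions for `β ≠ -1`, no nontrivial bounded
    -- solutions for any `β`, and only the solutions `(a x, ±a x)` for `β = -1`
    (β ≠ -1 →
      ¬ ∃ u v : ℝ → ℝ, IsHalfLineSolution q β u v ∧ InClassK C₁ C₂ C₃ C₄ (Ioi 0) u v ∧
        ∃ x, 0 < x ∧ (u x, v x) ≠ (0, 0)) ∧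
    (¬ ∃ u v : ℝ → ℝ, IsHalfLineSolution q β u v ∧ InClassK C₁ C₂ C₃ C₄ (Ioi 0) u v ∧
        (∃ M : ℝ, ∀ x, 0 < x → |u x| ≤ M ∧ |v x| ≤ M) ∧
        ∃ x, 0 < x ∧ (u x, v x) ≠ (0, 0)) ∧
    (β = -1 → ∀ u v : ℝ → ℝ,
      IsHalfLineSolution q β u v → InClassK C₁ C₂ C₃ C₄ (Ioi 0) u v →
        ∃ a : ℝ, (∀ x, 0 < x → u x = a * x) ∧
          ((∀ x, 0 < x → v x = a * x) ∨ (∀ x, 0 < x → v x = -(a * x)))) := by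
  have hq : -1 < q := by linarith
  obtain ⟨k, rfl⟩ : ∃ k, n = k + 1 := ⟨n - 1, by omega⟩
  have hk : k ≤ 2 := by omega
  -- For `n = 3` the critical exponent is `5`, and `2q + 3 < 5`.
  have hq1 : k = 2 → q < 1 := by
    rintro rfl
    rw [sobolevCriticalExponent, if_pos (by norm_num), EReal.coe_lt_coe_iff] at hpS
    norm_num at hpS
    linarith
  have hIoi : ∀ {f g : ℝ → ℝ}, InClassK C₁ C₂ C₃ C₄ (Ici 0) f g →
      InClassK C₁ C₂ C₃ C₄ (Ioi 0) f g := fun hK =>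
    hK.of_strictMono strictMono_id (fun x hx => Ioi_subset_Ici_self hx) (fun _ _ => rfl)
      (fun _ _ => rfl)
  -- The results above hold for `r > 0`; continuity of the profile adds the origin.
  have hprof : ∀ {w : EuclideanSpace ℝ (Fin (k + 1)) → ℝ} {f : ℝ → ℝ} {c : ℝ},
      HasRadialProfile w f → (∀ r, 0 < r → f r = c) → ∀ x, w x = c := by
    intro w f c hf hc x
    have h0 : ∀ r, 0 ≤ r → f r = f 0 := fun r hr =>
      eq_of_hasDerivAt_eq_zero_Ici (f' := fun _ => 0) hf.1 (fun r hr =>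
        (hasDerivAt_const r c).congr_of_eventuallyEq (by
          filter_upwards [Ioi_mem_nhds hr] with y hy using hc y hy)) (fun _ _ => rfl) hr
    rw [hf.2 x, h0 _ (norm_nonneg x), ← h0 1 zero_le_one, hc 1 one_pos]
  have hhalf : β ≠ -1 → ¬ ∃ u v : ℝ → ℝ, IsHalfLineSolution q β u v ∧
      InClassK C₁ C₂ C₃ C₄ (Ioi 0) u v ∧ ∃ x, 0 < x ∧ (u x, v x) ≠ (0, 0) := by
    rintro hβ ⟨u, v, h, hK, x, hx, hne⟩
    obtain ⟨e1, e2⟩ := h.radialSol.halfLine_eq_zero hq h.continuousOn_left h.boundary_left hK hβ x hx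
    exact hne (by rw [e1, e2])
  have hhalf' : β = -1 → ∀ u v : ℝ → ℝ,
      IsHalfLineSolution q β u v → InClassK C₁ C₂ C₃ C₄ (Ioi 0) u v →
        ∃ a : ℝ, (∀ x, 0 < x → u x = a * x) ∧
          ((∀ x, 0 < x → v x = a * x) ∨ (∀ x, 0 < x → v x = -(a * x))) := by
    rintro rfl u v h hK
    exact h.radialSol.halfLine_linear hq h.continuousOn_left h.boundary_left hK
  refine ⟨fun hβ => ⟨?_, ?_⟩, ?_, hhalf, ?_, hhalf'⟩
  · rintro ⟨u, v, f, g, h, hf, hg, hK, x, hx⟩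
    obtain ⟨f1, g1, hs, cf, cg, f0, -⟩ := h.exists_radialSol hf.2 hg.2
    have h0 := hs.eq_zero_of_ne hk hq hq1 hf.1 hg.1 cf cg f0 (hIoi hK) hβ
    exact hx (by rw [hprof hf (fun r hr => (h0 r hr).1), hprof hg (fun r hr => (h0 r hr).2)])
  · rintro ⟨u, v, h, hK, x, hx⟩
    obtain ⟨e1, e2⟩ := h.line_eq_zero hq hK hβ x
    exact hx (by rw [e1, e2])
  · rintro rfl
    refine ⟨fun u v f g h hf hg hK => ?_, fun u v h hK => ?_⟩
    · obtain ⟨f1, g1, hs, cf, cg, f0, -⟩ := h.exists_radialSol hf.2 hg.2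
      obtain ⟨hc, hfg⟩ := hs.const_of_eq hk hq hq1 hf.1 hg.1 cf cg f0 (hIoi hK)
      refine ⟨f 0, hprof hf fun r hr => hc r hr.le, hfg.imp (fun hfg => ?_) fun hfg => ?_⟩
      · exact hprof hg fun r hr => by rw [← hfg r hr, hc r hr.le]
      · exact hprof hg fun r hr => by rw [← hc r hr.le, hfg r hr, neg_neg]
    · obtain ⟨a, b, hu, hv⟩ := h.line_affine hq hK
      refine ⟨⟨a, b, hu, hv⟩, fun ⟨M, hM⟩ => ⟨b, ?_⟩⟩
      have ha : a = 0 := eq_zero_of_abs_mul_add_le (b := b) (M := M) fun x _ => by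
        rw [← hu x]; exact (hM x).1
      simpa [ha] using And.intro hu hv
  · rintro ⟨u, v, h, hK, ⟨M, hM⟩, x, hx, hne⟩
    by_cases hβ : β = -1
    · obtain ⟨a, hu, hv⟩ := hhalf' hβ u v h hK
      have ha : a = 0 := eq_zero_of_abs_mul_add_le (b := 0) (M := M) fun x hx => by
        rw [add_zero, ← hu x hx]; exact (hM x hx).1
      refine hne ?_
      rcases hv with hv | hv <;> simp [hu x hx, hv x hx, ha]
    · exact hhalf hβ ⟨u, v, h, hK, x, hx, hne⟩
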